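/- For every integer $t\ge 1$ let $n=2^t-1$, $q=2^{2t}$, $m=2^t+1$, $N=nm=q-1$, and $\Sigma=\mathbb F_q^m$. Let $\gamma$ be any generator of $\mathbb F_q^*$ and let $x_0\in\{0,1\}$. Let $\mathrm{RS}\subseteq\mathbb F_q^N$ be the Reed–Solomon code of all vectors $(f(x_0),f(\gamma),f(\gamma^2),\dots,f(\gamma^{N-1}))$, where $f\in\mathbb F_q[x]$ has degree at most $0.1N$ (that is, at most $\lfloor N/10\rfloor$), and let $C_n\subseteq\Sigma^n$ be its $m$-folded version, whose $i$-th symbol consists of the coordinates $(i-1)m+1,\dots,im$. In Bipartite NullCodeword, Alice gets functions $H_1,\dots,H_{\lfloor n/2\rfloor}:\Sigma\to\{0,1\}$ and Bob gets $H_{\lfloor n/2\rfloor+1},\dots,H_n:\Sigma\to\{0,1\}$; a valid solution is a codeword $x\in C_n$ with $H_i(x_i)=0$ for all $i\in[n]$. In the $p$-biased distribution all the bits $H_i(a)$ ($i\in[n]$, $a\in\Sigma$) are independent and each equals $1$ with probability $p$; here $p=2^{-6}$. In a quantum SMP protocol (without shared randomness or entanglement) Alice and Bob each send one quantum state, depending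 only on their own input, to Charlie, who then outputs an element of $\Sigma^n$; the cost is the total number of qubits sent. Consider the following quantum SMP protocol. For each $i\in[n]$ let $|\phi_i\rangle$ be the uniform superposition of the states $|e\rangle$ over all $e\in\Sigma$ with $H_i(e)=0$ (over all $e\in\Sigma$, if there is no such $e$). Alice sends $|\phi_1\rangle\otimes\dots\otimes|\phi_{\lfloor n/2\rfloor}\rangle$ and Bob sends $|\phi_{\lfloor n/2\rfloor+1}\rangle\otimes\dots\otimes|\phi_n\rangle$. Charlie prepares $|\psi\rangle=|C_n|^{-1/2}\sum_{x\in C_n}|x\rangle$ and applies $$(I\otimes\mathsf{QFT}^{-1})\,U_{\mathrm{decode}}\,U_{\mathrm{add}}\,(\mathsf{QFT}\otimes\mathsf{QFT})$$ to $|\psi\rangle\otimes(|\phi_1\rangle\otimes\dots\otimes|\phi_n\rangle)$, measures the second register and outputs the result. Here $\mathsf{QFT}|x\rangle=|\Sigma|^{-n/2}\sum_{z\in\Sigma^n}(-1)^{\mathrm{Tr}(x\cdot z)}|z\rangle$ with $\mathrm{Tr}$ the trace from $\mathbb F_q$ to $\mathbb F_2$, $U_{\mathrm{add}}|x\rangle|e\rangle=|x\rangle|x+e\rangle$,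 and $U_{\mathrm{decode}}|x\rangle|z\rangle=|x-\mathsf{Decode}(z)\rangle|z\rangle$, where $\mathsf{Decode}(z)$ is the unique element of the dual code $C_n^\perp$ whose Hamming distance from $z$, both regarded as vectors in $\mathbb F_q^N$, is at most $(p+0.01)N$, if there is exactly one such element, and $\mathsf{Decode}(z)=0$ otherwise. **Theorem.** This protocol uses $\mathrm{poly}(n)$ qubits, and when $(H_1,\dots,H_n)$ is drawn from the $p$-biased distribution with $p=2^{-6}$, Charlie outputs a valid solution with probability at least $1-2^{-\Omega(n)}$, over the input and the measurement. That is, there are a polynomial $Q$ with coefficients in $\mathbb N$ and real constants $K$ and $c>0$ such that for all $t\ge1$ and all $\gamma$ and $x_0$ as above the cost is at most $Q(n)$ and the success probability is at least $1-K\,2^{-cn}$. -/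

import Mathlib

open scoped Kronecker

noncomputable section

/-! ### Pure states and unitaries on finite-dimensional registers -/

/-- A pure state of a register with computational basis `ι`: a unit vector of amplitudes. -/
structure QState (ι : Type) [Fintype ι] where
  amp : ι → ℂ
  norm_sq : ∑ i, ‖amp i‖ ^ 2 = 1

/-- The tensor product of two states. -/
def QState.tensor {ι κ : Type} [Fintype ι] [Fintype κ] (φ : QState ι) (ψ : QState κ) :
    QState (ι × κ) where
  amp := fun x => φ.amp x.1 * ψ.amp x.2
  norm_sq := by
    simp only [norm_mul, mul_pow]
    rw [Fintype.sum_prod_type]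
    dsimp only
    rw [← Finset.sum_mul_sum, φ.norm_sq, ψ.norm_sq, one_mul]

/-- The tensor product `φ 0 ⊗ ⋯ ⊗ φ (s - 1)`, as a state of a register with basis `Fin s → ι`. -/
def QState.tensorPi {s : ℕ} {ι : Type} [Fintype ι] [DecidableEq ι] (φ : Fin s → QState ι) :
    QState (Fin s → ι) where
  amp := fun x => ∏ i, (φ i).amp (x i)
  norm_sq := by
    simp only [norm_prod, ← Finset.prod_pow]
    rw [← Fintype.prod_sum (fun i j => ‖(φ i).amp j‖ ^ 2)]
    simp [QState.norm_sq]

/-- The uniform superposition over a nonempty set of basis states. -/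
def QState.uniform {ι : Type} [Fintype ι] [DecidableEq ι] (S : Finset ι) (hS : S.Nonempty) :
    QState ι where
  amp := fun i => if i ∈ S then (((1 / Real.sqrt S.card : ℝ)) : ℂ) else 0
  norm_sq := by
    have h : ∀ i, ‖(if i ∈ S then (((1 / Real.sqrt S.card : ℝ)) : ℂ) else 0)‖ ^ 2
        = if i ∈ S then (1 / (S.card : ℝ)) else 0 := by
      intro i
      split_ifs
      · rw [Complex.norm_real, Real.norm_eq_abs, sq_abs, div_pow, one_pow,
          Real.sq_sqrt (Nat.cast_nonneg _)]
      · simp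
    simp only [h]
    have hc : (S.card : ℝ) ≠ 0 := by exact_mod_cast hS.card_pos.ne'
    simp [hc]

/-- The unitary `|j⟩ ↦ |σ j⟩` that permutes the basis states. -/
def permUnitary {ι : Type} [Fintype ι] [DecidableEq ι] (σ : Equiv.Perm ι) :
    Matrix.unitaryGroup ι ℂ :=
  ⟨Matrix.of fun i j => if i = σ j then 1 else 0, by
    rw [Matrix.mem_unitaryGroup_iff]
    ext i j
    rw [Matrix.mul_apply, ← Equiv.sum_comp σ.symm]
    simp [Matrix.star_apply, Matrix.one_apply]⟩

/-- The tensor product of two unitaries. -/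
def tensorUnitary {ι κ : Type} [Fintype ι] [DecidableEq ι] [Fintype κ] [DecidableEq κ]
    (U : Matrix.unitaryGroup ι ℂ) (V : Matrix.unitaryGroup κ ℂ) :
    Matrix.unitaryGroup (ι × κ) ℂ :=
  ⟨(U : Matrix ι ι ℂ) ⊗ₖ (V : Matrix κ κ ℂ), Matrix.kronecker_mem_unitary U.2 V.2⟩

/-- The same unitary after renaming the basis states along `e`. -/
def reindexUnitary {ι κ : Type} [Fintype ι] [DecidableEq ι] [Fintype κ] [DecidableEq κ]
    (e : ι ≃ κ) (U : Matrix.unitaryGroup κ ℂ) : Matrix.unitaryGroup ι ℂ :=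
  ⟨(U : Matrix κ κ ℂ).submatrix e e, by
    have h := Matrix.mem_unitaryGroup_iff.1 U.2
    rw [Matrix.mem_unitaryGroup_iff, Matrix.star_eq_conjTranspose, Matrix.conjTranspose_submatrix,
      Matrix.submatrix_mul_equiv, ← Matrix.star_eq_conjTranspose, h, Matrix.submatrix_one_equiv]⟩

/-! ### Quantum simultaneous message passing -/

/-- A quantum SMP protocol without shared randomness or entanglement. On inputs `x` and `y`, Alice
and Bob send the pure states `alice x` and `bob y` on registers of fixed finite dimension. Charlie
adjoins a fixed ancilla state, applies a fixed unitary, measures everything in the computational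
basis and outputs a function of the measured basis state. -/
structure QSMPProtocol (X Y O : Type) where
  RegA : Type
  RegB : Type
  RegC : Type
  fintypeA : Fintype RegA
  fintypeB : Fintype RegB
  fintypeC : Fintype RegC
  decEqA : DecidableEq RegA
  decEqB : DecidableEq RegB
  decEqC : DecidableEq RegC
  alice : X → QState RegA
  bob : Y → QState RegB
  ancilla : QState RegC
  unitary : Matrix.unitaryGroup (RegC × (RegA × RegB)) ℂ
  output : RegC × (RegA × RegB) → O

attribute [instance] QSMPProtocol.fintypeA QSMPProtocol.fintypeB QSMPProtocol.fintypeC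
  QSMPProtocol.decEqA QSMPProtocol.decEqB QSMPProtocol.decEqC

/-- The communication cost: the number of qubits sent by Alice plus the number sent by Bob, where a
register with `d` basis states consists of `⌈log₂ d⌉` qubits. -/
def QSMPProtocol.cost {X Y O : Type} (P : QSMPProtocol X Y O) : ℕ :=
  Nat.clog 2 (Fintype.card P.RegA) + Nat.clog 2 (Fintype.card P.RegB)

/-- The probability that Charlie measures the basis state `ω` on inputs `x` and `y`. -/
def QSMPProtocol.outcomeProb {X Y O : Type} (P : QSMPProtocol X Y O) (x : X) (y : Y)
    (ω : P.RegC × (P.RegA × P.RegB)) : ℝ :=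
  ‖((P.unitary : Matrix _ _ ℂ).mulVec
      (P.ancilla.tensor ((P.alice x).tensor (P.bob y))).amp) ω‖ ^ 2

open Classical in
/-- The probability that Charlie's output `o` on inputs `x` and `y` satisfies `R x y o`. -/
def QSMPProtocol.successProb {X Y O : Type} (P : QSMPProtocol X Y O) (R : X → Y → O → Prop)
    (x : X) (y : Y) : ℝ :=
  ∑ ω, if R x y (P.output ω) then P.outcomeProb x y ω else 0

/-! ### Words, codes and folding -/

/-- The alphabet `Σ = F ^ m`. -/
abbrev Alph (F : Type) (m : ℕ) : Type := Fin m → F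

/-- The words of length `n` over the alphabet `Σ = F ^ m`. -/
abbrev Word (F : Type) (n m : ℕ) : Type := Fin n → Alph F m

/-- The `m`-folding of a vector of length `n * m`: the `i`-th symbol consists of the coordinates
`i * m, …, i * m + (m - 1)`. -/
def foldWord {F : Type} {n m : ℕ} (x : Fin (n * m) → F) : Word F n m :=
  fun i j => x (finProdFinEquiv (i, j))

/-- The inverse of `foldWord`. -/
def unfoldWord {F : Type} {n m : ℕ} (z : Word F n m) : Fin (n * m) → F :=
  fun l => z (finProdFinEquiv.symm l).1 (finProdFinEquiv.symm l).2

/-- The evaluation points `x₀, γ, γ ^ 2, …, γ ^ (N - 1)`. -/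
def rsPoint {F : Type} [Field F] (N : ℕ) (x₀ γ : F) (j : Fin N) : F :=
  if (j : ℕ) = 0 then x₀ else γ ^ (j : ℕ)

/-- The Reed–Solomon code of length `N`: all `(f(x₀), f(γ), …, f(γ ^ (N - 1)))` for polynomials `f`
of degree at most `k`. -/
def rsCode {F : Type} [Field F] (N k : ℕ) (x₀ γ : F) : Submodule F (Fin N → F) :=
  (Polynomial.degreeLE F (k : WithBot ℕ)).map
    (LinearMap.pi fun j => Polynomial.leval (rsPoint N x₀ γ j))

/-- The dual of a linear code. -/
def dualCode {F : Type} [Field F] {N : ℕ} (C : Submodule F (Fin N → F)) :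
    Submodule F (Fin N → F) where
  carrier := {x | ∀ y ∈ C, x ⬝ᵥ y = 0}
  add_mem' := by
    intro a b ha hb y hy
    rw [add_dotProduct, ha y hy, hb y hy, add_zero]
  zero_mem' := by
    intro y _
    exact zero_dotProduct y
  smul_mem' := by
    intro c a ha y hy
    rw [smul_dotProduct, ha y hy, smul_zero]

/-- The `m`-folded version of a linear code. -/
def foldedCode {F : Type} [Field F] {n m : ℕ} (C : Submodule F (Fin (n * m) → F)) :
    Set (Word F n m) :=
  foldWord '' (C : Set (Fin (n * m) → F))

/-! ### Bipartite NullCodeword -/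

/-- Positions `0, …, ⌊n/2⌋ - 1` form the first half, the other positions form the second half. -/
def halves (n : ℕ) : Fin (n / 2) ⊕ Fin (n - n / 2) ≃ Fin n :=
  finSumFinEquiv.trans (finCongr (by omega))

/-- The first half of an `n`-tuple. -/
def firstHalf {n : ℕ} {A : Type} (x : Fin n → A) : Fin (n / 2) → A :=
  fun i => x (halves n (Sum.inl i))

/-- The second half of an `n`-tuple. -/
def secondHalf {n : ℕ} {A : Type} (x : Fin n → A) : Fin (n - n / 2) → A :=
  fun i => x (halves n (Sum.inr i))

/-- An `n`-tuple is the same as its pair of halves. -/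
def splitEquiv (n : ℕ) (A : Type) :
    (Fin n → A) ≃ (Fin (n / 2) → A) × (Fin (n - n / 2) → A) where
  toFun := fun x => (firstHalf x, secondHalf x)
  invFun := fun p i => Sum.elim p.1 p.2 ((halves n).symm i)
  left_inv := by
    intro x
    funext i
    obtain ⟨s, rfl⟩ := (halves n).surjective i
    rcases s with s | s <;> simp [firstHalf, secondHalf]
  right_inv := by
    rintro ⟨a, b⟩
    ext i <;> simp [firstHalf, secondHalf]

/-- The relation Bipartite NullCodeword for a code `C` of length `n` over the alphabet `A`; the bits
`0` and `1` are `false` and `true`. -/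
def BiNC {n : ℕ} {A : Type} (C : Set (Fin n → A)) (HA : Fin (n / 2) → A → Bool)
    (HB : Fin (n - n / 2) → A → Bool) (x : Fin n → A) : Prop :=
  x ∈ C ∧ (∀ i, HA i (firstHalf x i) = false) ∧ (∀ i, HB i (secondHalf x i) = false)

/-- The probability of the oracle `H = (H_1, …, H_n)` under the `p`-biased distribution: all the
bits `H_i(a)` are independent, and each of them is `1` with probability `p`. -/
def biasedProb {n : ℕ} {A : Type} [Fintype A] (p : ℝ) (H : Fin n → A → Bool) : ℝ :=
  ∏ i, ∏ a, if H i a = true then p else 1 - p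

/-! ### The quantum Fourier transform -/

/-- The additive character `x ↦ ω_p ^ Tr(x)` of a finite field `F` of characteristic `p`, where
`ω_p = exp(2πi/p)` and `Tr` is the trace to the prime field. -/
def traceChar (F : Type) [Field F] [Fintype F] : AddChar F ℂ :=
  haveI : Fact (ringChar F).Prime := ⟨CharP.char_is_prime F _⟩
  letI : Algebra (ZMod (ringChar F)) F := ZMod.algebra F (ringChar F)
  (ZMod.stdAddChar (N := ringChar F)).compAddMonoidHom
    (Algebra.trace (ZMod (ringChar F)) F).toAddMonoidHom

theorem traceChar_ne_one (F : Type) [Field F] [Fintype F] : traceChar F ≠ 1 := by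
  have : Fact (ringChar F).Prime := ⟨CharP.char_is_prime F _⟩
  let : Algebra (ZMod (ringChar F)) F := ZMod.algebra F (ringChar F)
  obtain ⟨a, ha⟩ := FiniteField.trace_to_zmod_nondegenerate F (one_ne_zero (α := F))
  rw [one_mul] at ha
  refine AddChar.ne_one_iff.2 ⟨a, fun hf => ha ?_⟩
  apply ZMod.injective_stdAddChar (N := ringChar F)
  rw [AddChar.map_zero_eq_one]
  exact hf

/-- The inner product `x · z` of two words. -/
def wordDot {F : Type} [Field F] {n m : ℕ} (x z : Word F n m) : F :=
  ∑ i, ∑ j, x i j * z i j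

/-- The character `z ↦ ω_p ^ Tr(x · z)` of the additive group of words. -/
def wordChar {F : Type} [Field F] [Fintype F] {n m : ℕ} (x : Word F n m) :
    AddChar (Word F n m) ℂ where
  toFun := fun z => traceChar F (wordDot x z)
  map_zero_eq_one' := by simp [wordDot]
  map_add_eq_mul' := by
    intro a b
    rw [← AddChar.map_add_eq_mul]
    simp [wordDot, mul_add, Finset.sum_add_distrib]

theorem sum_traceChar_wordDot {F : Type} [Field F] [Fintype F] {n m : ℕ} [DecidableEq F]
    (x : Word F n m) :
    ∑ z, traceChar F (wordDot x z) = if x = 0 then (Fintype.card (Word F n m) : ℂ) else 0 := by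
  split_ifs with h
  · subst h
    simp [wordDot]
  · have hx : ∃ i j, x i j ≠ 0 := by
      by_contra! hc
      exact h (by ext i j; exact hc i j)
    obtain ⟨i, j, hij⟩ := hx
    obtain ⟨a, ha⟩ := AddChar.ne_one_iff.1 (traceChar_ne_one F)
    refine AddChar.sum_eq_zero_of_ne_one (ψ := wordChar x)
      (AddChar.ne_one_iff.2 ⟨Pi.single i (Pi.single j ((x i j)⁻¹ * a)), ?_⟩)
    have : wordDot x (Pi.single i (Pi.single j ((x i j)⁻¹ * a))) = a := by
      unfold wordDot
      rw [Finset.sum_eq_single i, Finset.sum_eq_single j]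
      · simp [hij]
      · intro b _ hb
        simp [hb]
      · simp
      · intro b _ hb
        simp [hb]
      · simp
    change traceChar F (wordDot x _) ≠ 1
    rwa [this]

/-- The quantum Fourier transform `|x⟩ ↦ |Σ| ^ (-n/2) ∑_z ω_p ^ Tr(x · z) |z⟩` on `Σ ^ n`. -/
def qft (F : Type) [Field F] [Fintype F] [DecidableEq F] (n m : ℕ) :
    Matrix.unitaryGroup (Word F n m) ℂ :=
  ⟨Matrix.of fun z x => ((1 / Real.sqrt (Fintype.card (Word F n m)) : ℝ) : ℂ) * traceChar F (wordDot x z),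
  by
    rw [Matrix.mem_unitaryGroup_iff]
    ext u v
    have hc : (Fintype.card (Word F n m) : ℂ) ≠ 0 := by exact_mod_cast Fintype.card_ne_zero
    have hs : ((1 / Real.sqrt (Fintype.card (Word F n m)) : ℝ) : ℂ)
        * ((1 / Real.sqrt (Fintype.card (Word F n m)) : ℝ) : ℂ)
        = (Fintype.card (Word F n m) : ℂ)⁻¹ := by
      rw [← Complex.ofReal_mul, div_mul_div_comm, one_mul,
        Real.mul_self_sqrt (Nat.cast_nonneg _)]
      simp
    have hpos : 0 < ringChar F := (CharP.char_is_prime F (ringChar F)).pos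
    have key : ∀ x : Word F n m,
        (((1 / Real.sqrt (Fintype.card (Word F n m)) : ℝ) : ℂ) * traceChar F (wordDot x u))
        * star (((1 / Real.sqrt (Fintype.card (Word F n m)) : ℝ) : ℂ) * traceChar F (wordDot x v))
        = (Fintype.card (Word F n m) : ℂ)⁻¹ * traceChar F (wordDot (u - v) x) := by
      intro x
      have h1 : star (traceChar F (wordDot x v)) = traceChar F (-(wordDot x v)) := by
        have := AddChar.starComp_apply hpos (φ := traceChar F) (wordDot x v)
        rw [AddChar.inv_apply] at this
        exact this
      have h2 : wordDot (u - v) x = wordDot x u + -(wordDot x v) := by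
        simp only [wordDot, Pi.sub_apply, sub_mul, Finset.sum_sub_distrib]
        rw [← sub_eq_add_neg]
        simp only [mul_comm]
      rw [h2, AddChar.map_add_eq_mul, star_mul', h1, ← hs]
      have h3 : star ((1 / Real.sqrt (Fintype.card (Word F n m)) : ℝ) : ℂ)
          = ((1 / Real.sqrt (Fintype.card (Word F n m)) : ℝ) : ℂ) := Complex.conj_ofReal _
      rw [h3]
      ring
    rw [Matrix.mul_apply]
    simp only [Matrix.star_apply, Matrix.of_apply]
    rw [Finset.sum_congr rfl (fun x _ => key x), ← Finset.mul_sum, sum_traceChar_wordDot,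
      Matrix.one_apply]
    by_cases huv : u = v
    · simp [huv]
    · simp [huv, sub_eq_zero]⟩

/-! ### The protocol -/

open Classical in
/-- Decoding of (the folded version of) a linear code `D` up to radius `r`: if there is exactly one
codeword of `D` at Hamming distance at most `r` from the unfolded word, return its folded version;
otherwise (decoding failure) return the zero word. -/
def decode {F : Type} [Field F] [DecidableEq F] {n m : ℕ}
    (D : Submodule F (Fin (n * m) → F)) (r : ℝ) (z : Word F n m) : Word F n m :=
  if h : ∃! x, x ∈ D ∧ (hammingDist (unfoldWord z) x : ℝ) ≤ r then foldWord h.choose else 0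

/-- `|x⟩|e⟩ ↦ |x⟩|x + e⟩`. -/
def addUnitary (F : Type) [Field F] [Fintype F] [DecidableEq F] (n m : ℕ) :
    Matrix.unitaryGroup (Word F n m × Word F n m) ℂ :=
  permUnitary
    { toFun := fun y => (y.1, y.1 + y.2)
      invFun := fun y => (y.1, y.2 - y.1)
      left_inv := by intro y; simp
      right_inv := by intro y; simp }

/-- `|x⟩|z⟩ ↦ |x - G z⟩|z⟩`. -/
def subUnitary {F : Type} [Field F] [Fintype F] [DecidableEq F] {n m : ℕ}
    (G : Word F n m → Word F n m) :
    Matrix.unitaryGroup (Word F n m × Word F n m) ℂ :=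
  permUnitary
    { toFun := fun y => (y.1 - G y.2, y.2)
      invFun := fun y => (y.1 + G y.2, y.2)
      left_inv := by intro y; simp
      right_inv := by intro y; simp }

/-- Charlie's processing stage `(I ⊗ QFT⁻¹) U_decode U_add (QFT ⊗ QFT)` for the decoder `G`. -/
def processUnitary {F : Type} [Field F] [Fintype F] [DecidableEq F] {n m : ℕ}
    (G : Word F n m → Word F n m) :
    Matrix.unitaryGroup (Word F n m × Word F n m) ℂ :=
  tensorUnitary 1 (qft F n m)⁻¹ * subUnitary G * addUnitary F n m
    * tensorUnitary (qft F n m) (qft F n m)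

/-- The uniform superposition over the zero-preimages of `h`. If there are none, where that is
undefined, the uniform superposition over the whole domain is taken. -/
def zeroState {A : Type} [Fintype A] [DecidableEq A] [Nonempty A] (h : A → Bool) : QState A :=
  if hS : (Finset.univ.filter fun a => h a = false).Nonempty then QState.uniform _ hS
  else QState.uniform Finset.univ Finset.univ_nonempty

open Classical in
/-- The uniform superposition over the folded version of a linear code. -/
def codeState {F : Type} [Field F] [Fintype F] [DecidableEq F] {n m : ℕ}
    (C : Submodule F (Fin (n * m) → F)) : QState (Word F n m) :=
  QState.uniform (Finset.univ.filter fun x => x ∈ foldedCode C)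
    ⟨foldWord 0, by simpa [foldedCode] using ⟨0, C.zero_mem, rfl⟩⟩

/-- The quantum SMP protocol for Bipartite NullCodeword with the `m`-folded code `C`. Alice and Bob
send the uniform superpositions over the zero-preimages of their functions. Charlie adjoins the
uniform superposition over the code, applies `processUnitary` with the decoder of the dual code up
to radius `r`, and outputs the second register. -/
def nullCodewordProtocol {F : Type} [Field F] [Fintype F] [DecidableEq F] {n m : ℕ}
    (C : Submodule F (Fin (n * m) → F)) (r : ℝ) :
    QSMPProtocol (Fin (n / 2) → Alph F m → Bool) (Fin (n - n / 2) → Alph F m → Bool)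
      (Word F n m) where
  RegA := Fin (n / 2) → Alph F m
  RegB := Fin (n - n / 2) → Alph F m
  RegC := Word F n m
  fintypeA := inferInstance
  fintypeB := inferInstance
  fintypeC := inferInstance
  decEqA := inferInstance
  decEqB := inferInstance
  decEqC := inferInstance
  alice := fun HA => QState.tensorPi fun i => zeroState (HA i)
  bob := fun HB => QState.tensorPi fun i => zeroState (HB i)
  ancilla := codeState C
  unitary := reindexUnitary
    (Equiv.prodCongr (Equiv.refl (Word F n m)) (splitEquiv n (Alph F m)).symm)
    (processUnitary (decode (dualCode C) r))
  output := fun ω => (splitEquiv n (Alph F m)).symm ω.2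

/-! ### The parameters -/

/-- The length `n = 2 ^ t - 1` of the folded code. -/
abbrev codeLen (t : ℕ) : ℕ := 2 ^ t - 1

/-- The folding parameter `m = 2 ^ t + 1`. -/
abbrev foldLen (t : ℕ) : ℕ := 2 ^ t + 1

/-- The length `N = n * m = q - 1`, with `q = 2 ^ (2 * t)`, of the unfolded code. -/
theorem codeLen_mul_foldLen (t : ℕ) : codeLen t * foldLen t = 2 ^ (2 * t) - 1 := by
  have h := Nat.sq_sub_sq (2 ^ t) 1
  rw [one_pow] at h
  rw [mul_comm 2 t, pow_mul, h, mul_comm]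

/-- The Reed–Solomon code of length `N = q - 1` with polynomials of degree at most `0.1 N`. -/
def baseCode {F : Type} [Field F] (t : ℕ) (x₀ γ : F) :
    Submodule F (Fin (codeLen t * foldLen t) → F) :=
  rsCode (codeLen t * foldLen t) (codeLen t * foldLen t / 10) x₀ γ

/-- The bias `p = 2 ^ (-6)`. -/
def biasP : ℝ := 1 / 2 ^ 6

/-- The decoding radius `(p + 0.01) N` for the dual code. -/
def decodingRadius (t : ℕ) : ℝ := (biasP + 1 / 100) * ((codeLen t * foldLen t : ℕ) : ℝ)

end

/-! Let ψ be the code state and φ the joint message, with hats for Fourier transforms. After `QFT ⊗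
QFT` and `U_add` the registers hold ∑ ψ̂(x) φ̂(e) |x⟩|x+e⟩, where ψ̂ lives on the dual code. If the
decoder always recovered x from x+e, the first register would become |0⟩ and the second the
convolution of ψ̂ and φ̂, which the inverse transform turns into √|Σⁿ| · ψφ
(`inverse_stage_convolution`). When every H_i has a zero, this vector is supported on valid
solutions. It need not have norm 1: only its support matters.

Decoding can fail only for errors e in the set B of words of weight above r, because nonzero dual
codewords have weight above 2r (`lt_hammingNorm_of_mem_dualCode_rsCode`, `decode_eq`). The actual
and the ideal vectors are both linear in φ̂ and agree on its part off B, so their difference comes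
from φ̂·1_B alone. That part contributes ‖φ̂·1_B‖² to the actual squared norm, and |Σⁿ| ∑ |ψ(u)|²
|g(u)|² to the ideal one, where g is the inverse transform of φ̂·1_B (`sum_process_outside_le`). For
a fixed input the second quantity is not controlled by the first. But the biased distribution is
invariant under translations of the H_i, so the mean of |g(u)|² does not depend on u, and both
quantities have the same mean (`expected_ideal_error`).

Finally, φ is a product of independent factors, so the mean of |φ̂|² is a product distribution in
which each symbol is nonzero with probability at most p (`one_sub_le_symbolDist_zero`). Weight above
(p+0.01)N requires more than (p+0.01)n nonzero symbols, which a Chernoff bound makes exponentially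
unlikely (`sum_prod_le_of_card_ne_zero`). -/

noncomputable section

set_option linter.unusedSectionVars false

/-! ### Action of the unitaries on vectors -/

theorem permUnitary_mulVec {ι : Type} [Fintype ι] [DecidableEq ι] (σ : Equiv.Perm ι)
    (v : ι → ℂ) (i : ι) : (permUnitary σ : Matrix ι ι ℂ).mulVec v i = v (σ.symm i) := by
  have h : ∀ j, (i = σ j) ↔ (j = σ.symm i) := fun j => by
    rw [Equiv.eq_symm_apply, eq_comm]
  simp [permUnitary, Matrix.mulVec, dotProduct, h]

theorem sum_norm_sq_unitary_mulVec {ι : Type} [Fintype ι] [DecidableEq ι]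
    (U : Matrix.unitaryGroup ι ℂ) (v : ι → ℂ) :
    ∑ i, ‖(U : Matrix ι ι ℂ).mulVec v i‖ ^ 2 = ∑ i, ‖v i‖ ^ 2 := by
  have h : ∀ w : ι → ℂ, ((∑ i, ‖w i‖ ^ 2 : ℝ) : ℂ) = star w ⬝ᵥ w := by
    intro w
    simp [dotProduct, Complex.conj_mul']
  have hU : (U : Matrix ι ι ℂ).conjTranspose * (U : Matrix ι ι ℂ) = 1 :=
    Matrix.mem_unitaryGroup_iff'.1 U.2
  apply Complex.ofReal_injective
  rw [h, h, Matrix.star_mulVec, Matrix.dotProduct_mulVec, Matrix.vecMul_vecMul, hU,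
    Matrix.vecMul_one]

theorem tensorUnitary_mulVec {ι κ : Type} [Fintype ι] [DecidableEq ι] [Fintype κ] [DecidableEq κ]
    (U : Matrix.unitaryGroup ι ℂ) (V : Matrix.unitaryGroup κ ℂ) (v : ι → ℂ) (w : κ → ℂ)
    (x : ι × κ) :
    (tensorUnitary U V : Matrix (ι × κ) (ι × κ) ℂ).mulVec (fun y => v y.1 * w y.2) x
      = (U : Matrix ι ι ℂ).mulVec v x.1 * (V : Matrix κ κ ℂ).mulVec w x.2 := by
  simp only [tensorUnitary, Matrix.mulVec, dotProduct, Matrix.kroneckerMap_apply]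
  rw [Fintype.sum_prod_type, Finset.sum_mul_sum]
  exact Finset.sum_congr rfl fun i _ => Finset.sum_congr rfl fun j _ => by ring

/-! ### The Fourier transform on words -/

section Fourier

variable {F : Type} [Field F] [Fintype F] {n m : ℕ}

theorem wordDot_comm (x z : Word F n m) : wordDot x z = wordDot z x := by
  simp only [wordDot, mul_comm]

theorem wordDot_add_left (x y z : Word F n m) :
    wordDot (x + y) z = wordDot x z + wordDot y z := by
  simp [wordDot, add_mul, Finset.sum_add_distrib]

theorem traceChar_mul_neg (a : F) : traceChar F a * traceChar F (-a) = 1 := by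
  rw [← AddChar.map_add_eq_mul, add_neg_cancel, AddChar.map_zero_eq_one]

variable [DecidableEq F]

/-- The square root of the number of words. -/
def rootCard (F : Type) [Fintype F] (n m : ℕ) [DecidableEq F] : ℝ :=
  Real.sqrt (Fintype.card (Word F n m))

theorem rootCard_sq : rootCard F n m ^ 2 = Fintype.card (Word F n m) :=
  Real.sq_sqrt (Nat.cast_nonneg _)

theorem rootCard_pos : 0 < rootCard F n m :=
  Real.sqrt_pos.2 (by exact_mod_cast Fintype.card_pos)

theorem rootCard_ne_zero : (rootCard F n m : ℂ) ≠ 0 := by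
  exact_mod_cast rootCard_pos.ne'

/-- The Fourier transform of a vector of amplitudes. -/
def wordFourier (f : Word F n m → ℂ) : Word F n m → ℂ := (qft F n m : Matrix _ _ ℂ).mulVec f

/-- The inverse Fourier transform of a vector of amplitudes. -/
def wordFourierInv (f : Word F n m → ℂ) : Word F n m → ℂ :=
  ((qft F n m)⁻¹ : Matrix.unitaryGroup _ ℂ).1.mulVec f

theorem wordFourier_apply (f : Word F n m → ℂ) (z : Word F n m) :
    wordFourier f z = (rootCard F n m : ℂ)⁻¹ * ∑ x, traceChar F (wordDot x z) * f x := by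
  simp [wordFourier, qft, Matrix.mulVec, dotProduct, rootCard, Finset.mul_sum, mul_assoc]

theorem wordFourierInv_wordFourier (f : Word F n m → ℂ) : wordFourierInv (wordFourier f) = f := by
  have h : ((qft F n m)⁻¹ : Matrix.unitaryGroup _ ℂ).1 * (qft F n m).1 = 1 :=
    congrArg Subtype.val (inv_mul_cancel (qft F n m))
  rw [wordFourierInv, wordFourier, Matrix.mulVec_mulVec, h, Matrix.one_mulVec]

theorem wordFourier_wordFourierInv (f : Word F n m → ℂ) : wordFourier (wordFourierInv f) = f := by
  have h : (qft F n m).1 * ((qft F n m)⁻¹ : Matrix.unitaryGroup _ ℂ).1 = 1 :=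
    congrArg Subtype.val (mul_inv_cancel (qft F n m))
  rw [wordFourierInv, wordFourier, Matrix.mulVec_mulVec, h, Matrix.one_mulVec]

theorem sum_norm_sq_wordFourier (f : Word F n m → ℂ) :
    ∑ z, ‖wordFourier f z‖ ^ 2 = ∑ x, ‖f x‖ ^ 2 :=
  sum_norm_sq_unitary_mulVec _ _

theorem sum_norm_sq_wordFourierInv (f : Word F n m → ℂ) :
    ∑ z, ‖wordFourierInv f z‖ ^ 2 = ∑ x, ‖f x‖ ^ 2 :=
  sum_norm_sq_unitary_mulVec _ _

theorem wordFourier_shift (f : Word F n m → ℂ) (u z : Word F n m) :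
    wordFourier (fun x => f (x + u)) z = traceChar F (-(wordDot u z)) * wordFourier f z := by
  rw [wordFourier_apply, wordFourier_apply, mul_left_comm]
  congr 1
  rw [Finset.mul_sum, ← Equiv.sum_comp (Equiv.addRight u) (fun x => traceChar F (-(wordDot u z)) *
    (traceChar F (wordDot x z) * f x))]
  refine Finset.sum_congr rfl fun x _ => ?_
  simp only [Equiv.coe_addRight, wordDot_add_left, AddChar.map_add_eq_mul]
  linear_combination (-(traceChar F (wordDot x z) * f (x + u))) *
    traceChar_mul_neg (wordDot u z)

theorem wordFourierInv_modulate (f : Word F n m → ℂ) (u : Word F n m) :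
    wordFourierInv (fun z => traceChar F (-(wordDot u z)) * f z)
      = fun x => wordFourierInv f (x + u) := by
  conv_lhs => rw [← wordFourier_wordFourierInv f]
  rw [← wordFourierInv_wordFourier (fun x => wordFourierInv f (x + u))]
  congr 1
  funext z
  rw [wordFourier_shift]

/-- The Fourier transform turns products into convolutions. -/
theorem sum_wordFourier_mul_wordFourier (f g : Word F n m → ℂ) (z : Word F n m) :
    ∑ x, wordFourier f x * wordFourier g (z - x)
      = rootCard F n m * wordFourier (fun u => f u * g u) z := by
  have hs : ∀ x, wordFourier f x * wordFourier g (z - x)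
      = ∑ u, ((rootCard F n m : ℂ)⁻¹ * traceChar F (wordDot u z) * g u) *
          ((rootCard F n m : ℂ)⁻¹ * ∑ v, traceChar F (wordDot (v - u) x) * f v) := by
    intro x
    rw [wordFourier_apply f, wordFourier_apply g]
    simp only [Finset.mul_sum, Finset.sum_mul]
    refine Finset.sum_congr rfl fun u _ => Finset.sum_congr rfl fun v _ => ?_
    have h1 : wordDot (v - u) x = wordDot v x + -(wordDot u x) := by
      simp [wordDot, sub_mul, ← sub_eq_add_neg]
    have h2 : wordDot u (z - x) = wordDot u z + -(wordDot u x) := by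
      simp [wordDot, mul_sub, ← sub_eq_add_neg]
    rw [h1, h2, AddChar.map_add_eq_mul, AddChar.map_add_eq_mul]
    ring
  have hcard : (Fintype.card (Word F n m) : ℂ) = (rootCard F n m : ℂ) ^ 2 := by
    rw [← Complex.ofReal_pow, rootCard_sq]; simp
  -- Orthogonality of characters: the sum over `x` keeps only `v = u`.
  have hv : ∀ u, ∑ x, ((rootCard F n m : ℂ)⁻¹ * ∑ v, traceChar F (wordDot (v - u) x) * f v)
      = rootCard F n m * f u := by
    intro u
    rw [← Finset.mul_sum, Finset.sum_comm]
    simp only [← Finset.sum_mul, sum_traceChar_wordDot, sub_eq_zero, ite_mul, zero_mul,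
      Finset.sum_ite_eq', Finset.mem_univ, if_true, hcard]
    field_simp [rootCard_ne_zero (F := F) (n := n) (m := m)]
  rw [Finset.sum_congr rfl fun x _ => hs x, Finset.sum_comm]
  simp only [← Finset.mul_sum]
  simp only [Finset.mul_sum] at hv
  simp only [Finset.mul_sum, hv, wordFourier_apply]
  refine Finset.sum_congr rfl fun u _ => ?_
  ring

/-- Parseval applied to the convolution theorem. It measures the ideal, perfectly decoded vector. -/
theorem sum_norm_sq_convolution (f b : Word F n m → ℂ) :
    ∑ z, ‖∑ x, wordFourier f x * b (z - x)‖ ^ 2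
      = Fintype.card (Word F n m) * ∑ u, ‖f u‖ ^ 2 * ‖wordFourierInv b u‖ ^ 2 := by
  have h := fun z => sum_wordFourier_mul_wordFourier f (wordFourierInv b) z
  simp only [wordFourier_wordFourierInv] at h
  simp only [h, norm_mul, mul_pow, ← Finset.mul_sum, sum_norm_sq_wordFourier]
  rw [Complex.norm_real, Real.norm_eq_abs, sq_abs, rootCard_sq]

end Fourier

/-! ### Distance of the dual code -/

/-- If the support of `x` had at most `k` points, the polynomial vanishing at all of them except `j`
would have degree at most `k`, and its pairing with `x` would reduce to the single nonzero term at
`j`. -/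
theorem lt_hammingNorm_of_mem_dualCode_rsCode {F : Type} [Field F] [DecidableEq F] {N k : ℕ}
    {x₀ γ : F} (hinj : Function.Injective (rsPoint N x₀ γ)) {x : Fin N → F}
    (hx : x ∈ dualCode (rsCode N k x₀ γ)) (hx0 : x ≠ 0) : k < hammingNorm x := by
  by_contra! hle
  obtain ⟨j, hj⟩ := Function.ne_iff.1 hx0
  have hj' : x j ≠ 0 := hj
  set S : Finset (Fin N) := Finset.univ.filter fun i => x i ≠ 0 with hS
  have hjS : j ∈ S := by simp [hS, hj']
  set f : Polynomial F := ∏ i ∈ S.erase j, (Polynomial.X - Polynomial.C (rsPoint N x₀ γ i))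
    with hf
  have hdeg : f ∈ Polynomial.degreeLE F (k : WithBot ℕ) := by
    rw [Polynomial.mem_degreeLE, hf, Polynomial.degree_prod_of_monic _ _
      fun i _ => Polynomial.monic_X_sub_C _]
    simp only [Polynomial.degree_X_sub_C, Finset.sum_const, nsmul_eq_mul, mul_one]
    have : (S.erase j).card ≤ k :=
      (Finset.card_le_card (Finset.erase_subset _ _)).trans hle
    exact_mod_cast this
  have hmem : (fun i => f.eval (rsPoint N x₀ γ i)) ∈ rsCode N k x₀ γ :=
    ⟨f, hdeg, rfl⟩
  have h0 := hx _ hmem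
  have hzero : ∀ i, i ≠ j → x i * f.eval (rsPoint N x₀ γ i) = 0 := by
    intro i hij
    by_cases hi : x i = 0
    · rw [hi, zero_mul]
    · rw [hf, Polynomial.eval_prod, Finset.prod_eq_zero (i := i), mul_zero]
      · simp [hS, hi, hij]
      · simp
  rw [dotProduct, Finset.sum_eq_single j (fun i _ hij => hzero i hij) (by simp)] at h0
  rcases mul_eq_zero.1 h0 with h | h
  · exact hj' h
  · rw [hf, Polynomial.eval_prod, Finset.prod_eq_zero_iff] at h
    obtain ⟨i, hi, h⟩ := h
    simp only [Polynomial.eval_sub, Polynomial.eval_X, Polynomial.eval_C, sub_eq_zero] at h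
    exact (Finset.ne_of_mem_erase hi) (hinj h).symm

/-- A generator has order `N`, so its powers with exponents below `N` are distinct. Replacing γ⁰ = 1
by 0 keeps them distinct because powers of γ are nonzero. -/
theorem rsPoint_injective {F : Type} [Field F] [Fintype F] {N : ℕ} (hN : N + 1 = Fintype.card F)
    {γ : Fˣ} (hγ : ∀ y : Fˣ, y ∈ Subgroup.zpowers γ) {x₀ : F} (hx₀ : x₀ = 0 ∨ x₀ = 1) :
    Function.Injective (rsPoint N x₀ (γ : F)) := by
  classical
  have hord : orderOf γ = N := by
    rw [orderOf_eq_card_of_forall_mem_zpowers hγ, Nat.card_eq_fintype_card, Fintype.card_units,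
      ← hN, Nat.add_sub_cancel]
  have hpow : ∀ i j : Fin N, (γ : F) ^ (i : ℕ) = (γ : F) ^ (j : ℕ) → i = j := by
    intro i j h
    refine Fin.ext (pow_injOn_Iio_orderOf (x := γ) ?_ ?_ ?_)
    · simp [hord]
    · simp [hord]
    · exact Units.ext (by simpa using h)
  have hne : ∀ j : ℕ, (γ : F) ^ j ≠ 0 := fun j => pow_ne_zero _ γ.ne_zero
  rcases hx₀ with rfl | rfl
  · intro i j h
    unfold rsPoint at h
    split_ifs at h with hi hj hj
    · exact Fin.ext (hi.trans hj.symm)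
    · exact absurd h.symm (hne _)
    · exact absurd h (hne _)
    · exact hpow i j h
  · have h1 : ∀ i : Fin N, rsPoint N 1 (γ : F) i = (γ : F) ^ (i : ℕ) := by
      intro i
      unfold rsPoint
      split_ifs with hi
      · rw [hi, pow_zero]
      · rfl
    intro i j h
    exact hpow i j (by rwa [h1, h1] at h)

/-! ### Folding and decoding -/

theorem unfoldWord_foldWord {F : Type} {n m : ℕ} (x : Fin (n * m) → F) :
    unfoldWord (foldWord x) = x := by
  funext l
  change x (finProdFinEquiv (finProdFinEquiv.symm l)) = x l
  rw [Equiv.apply_symm_apply]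

theorem foldWord_unfoldWord {F : Type} {n m : ℕ} (z : Word F n m) :
    foldWord (unfoldWord z) = z := by
  funext i j
  simp [foldWord, unfoldWord]

theorem unfoldWord_sub {F : Type} [Field F] {n m : ℕ} (x z : Word F n m) :
    unfoldWord (x - z) = unfoldWord x - unfoldWord z := rfl

theorem wordDot_eq_dotProduct {F : Type} [Field F] {n m : ℕ} (x z : Word F n m) :
    wordDot x z = unfoldWord x ⬝ᵥ unfoldWord z := by
  rw [dotProduct, ← Equiv.sum_comp finProdFinEquiv, Fintype.sum_prod_type]
  simp [wordDot, unfoldWord]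

/-- The Hamming weight of the unfolded word. -/
def wordWeight {F : Type} [Field F] [DecidableEq F] {n m : ℕ} (z : Word F n m) : ℕ :=
  hammingNorm (unfoldWord z)

/-- Decoding counts field coordinates, whereas independence holds per folded symbol. Each nonzero
symbol accounts for at most `m` coordinates. -/
theorem wordWeight_le {F : Type} [Field F] [DecidableEq F] {n m : ℕ} (z : Word F n m) :
    wordWeight z ≤ m * (Finset.univ.filter fun i => z i ≠ 0).card := by
  rw [wordWeight, hammingNorm]
  have h : (Finset.univ.filter fun l => unfoldWord z l ≠ 0).card
      ≤ ((Finset.univ.filter fun i => z i ≠ 0) ×ˢ (Finset.univ : Finset (Fin m))).card := by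
    refine Finset.card_le_card_of_injOn finProdFinEquiv.symm ?_
      finProdFinEquiv.symm.injective.injOn
    intro l hl
    simp only [Finset.coe_filter, Finset.mem_univ, true_and, Set.mem_ofPred_eq] at hl
    simp only [Finset.coe_product, Finset.coe_filter, Finset.mem_univ, true_and,
      Finset.coe_univ, Set.mem_prod, Set.mem_ofPred_eq, Set.mem_univ, and_true]
    intro h0
    apply hl
    simp only [unfoldWord, h0, Pi.zero_apply]
  simpa [mul_comm] using h

theorem hammingNorm_sub {F : Type} [Field F] [DecidableEq F] {N : ℕ} (x y : Fin N → F) :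
    hammingNorm (x - y) = hammingDist x y := by
  simp [hammingNorm, hammingDist, sub_ne_zero]

theorem unique_of_hammingDist_le {F : Type} [Field F] [DecidableEq F] {N : ℕ}
    {D : Submodule F (Fin N → F)} {r : ℝ} (hD : ∀ x ∈ D, x ≠ 0 → 2 * r < hammingNorm x)
    {z x y : Fin N → F} (hx : x ∈ D) (hy : y ∈ D) (hzx : (hammingDist z x : ℝ) ≤ r)
    (hzy : (hammingDist z y : ℝ) ≤ r) : x = y := by
  by_contra hne
  have h1 := hD _ (D.sub_mem hx hy) (sub_ne_zero.2 hne)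
  rw [hammingNorm_sub] at h1
  have h2 : (hammingDist x y : ℝ) ≤ hammingDist z x + hammingDist z y := by
    exact_mod_cast hammingDist_triangle_left x y z
  linarith

theorem decode_eq {F : Type} [Field F] [DecidableEq F] {n m : ℕ}
    {D : Submodule F (Fin (n * m) → F)} {r : ℝ} (hD : ∀ x ∈ D, x ≠ 0 → 2 * r < hammingNorm x)
    {z x : Word F n m} (hx : unfoldWord x ∈ D) (hzx : (wordWeight (z - x) : ℝ) ≤ r) :
    decode D r z = x := by
  rw [wordWeight, unfoldWord_sub, hammingNorm_sub] at hzx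
  have h : ∃! x, x ∈ D ∧ (hammingDist (unfoldWord z) x : ℝ) ≤ r :=
    ⟨unfoldWord x, ⟨hx, hzx⟩, fun y hy => unique_of_hammingDist_le hD hy.1 hx hy.2 hzx⟩
  have h2 := h.choose_spec.1
  rw [decode, dif_pos h, ← foldWord_unfoldWord x]
  congr 1
  exact unique_of_hammingDist_le hD h2.1 hx h2.2 hzx

/-! ### The code state and its Fourier transform -/

section Processing

variable {F : Type} [Field F] [Fintype F] [DecidableEq F] {n m : ℕ}

theorem codeState_amp_add (C : Submodule F (Fin (n * m) → F)) {y : Fin (n * m) → F} (hy : y ∈ C)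
    (x : Word F n m) : (codeState C).amp (x + foldWord y) = (codeState C).amp x := by
  have h : x + foldWord y ∈ foldedCode C ↔ x ∈ foldedCode C := by
    constructor
    · rintro ⟨w, hw, h⟩
      exact ⟨w - y, C.sub_mem hw hy, by rw [← add_sub_cancel_right x (foldWord y), ← h]; rfl⟩
    · rintro ⟨w, hw, rfl⟩
      exact ⟨w + y, C.add_mem hw hy, rfl⟩
  exact if_congr (by simp [h]) rfl rfl

theorem codeState_amp_eq_zero (C : Submodule F (Fin (n * m) → F)) {x : Word F n m}
    (hx : x ∉ foldedCode C) : (codeState C).amp x = 0 := by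
  simp [codeState, QState.uniform, hx]

/-- The code state is invariant under translation by codewords, which multiplies the transform at
`z` by a character value. Off the dual code some codeword makes that value differ from 1. -/
theorem wordFourier_codeState_eq_zero (C : Submodule F (Fin (n * m) → F)) {z : Word F n m}
    (hz : unfoldWord z ∉ dualCode C) : wordFourier (codeState C).amp z = 0 := by
  have hz' : ∃ y ∈ C, unfoldWord z ⬝ᵥ y ≠ 0 := by
    by_contra! h
    exact hz h
  obtain ⟨y, hy, hc⟩ := hz'
  obtain ⟨a, ha⟩ := AddChar.ne_one_iff.1 (traceChar_ne_one F)
  -- The multiple of `y` is chosen so that minus its inner product with `z` is `a`.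
  have h := wordFourier_shift (codeState C).amp
    (foldWord ((-a * (unfoldWord z ⬝ᵥ y)⁻¹) • y)) z
  simp only [codeState_amp_add C (C.smul_mem _ hy)] at h
  rw [wordDot_comm, wordDot_eq_dotProduct, unfoldWord_foldWord, dotProduct_smul, smul_eq_mul,
    inv_mul_cancel_right₀ hc, neg_neg] at h
  have h2 : (1 - traceChar F a) * wordFourier (codeState C).amp z = 0 := by
    linear_combination h
  exact (mul_eq_zero.1 h2).resolve_left (sub_ne_zero.2 (Ne.symm ha))

/-! ### Error of the processing stage -/

theorem processUnitary_mulVec (G : Word F n m → Word F n m) (ψ φ : Word F n m → ℂ) :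
    (processUnitary G : Matrix _ _ ℂ).mulVec
        (fun y : Word F n m × Word F n m => ψ y.1 * φ y.2)
      = (tensorUnitary 1 (qft F n m)⁻¹ : Matrix.unitaryGroup _ ℂ).1.mulVec
          (fun y : Word F n m × Word F n m =>
            wordFourier ψ (y.1 + G y.2) * wordFourier φ (y.2 - y.1 - G y.2)) := by
  simp only [processUnitary, Matrix.UnitaryGroup.mul_val, ← Matrix.mulVec_mulVec]
  congr 1
  funext y
  rw [subUnitary, permUnitary_mulVec, addUnitary, permUnitary_mulVec, tensorUnitary_mulVec]
  simp only [Equiv.coe_fn_symm_mk, wordFourier, sub_add_eq_sub_sub]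

theorem norm_add_sq_le_two_mul (a b : ℂ) : ‖a + b‖ ^ 2 ≤ 2 * ‖a‖ ^ 2 + 2 * ‖b‖ ^ 2 := by
  have h := norm_add_le a b
  nlinarith [sq_nonneg (‖a‖ - ‖b‖), norm_nonneg (a + b), norm_nonneg a, norm_nonneg b]

/-- The part of a vector of amplitudes supported on a set. -/
def restrictAmp (B : Set (Word F n m)) [DecidablePred (· ∈ B)] (f : Word F n m → ℂ) :
    Word F n m → ℂ :=
  fun z => if z ∈ B then f z else 0

theorem inverse_stage_convolution (ψ φ : Word F n m → ℂ) (y : Word F n m × Word F n m) :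
    (tensorUnitary 1 (qft F n m)⁻¹ : Matrix.unitaryGroup (Word F n m × Word F n m) ℂ).1.mulVec
        (fun y => (if y.1 = 0 then 1 else 0) *
          ∑ x, wordFourier ψ x * wordFourier φ (y.2 - x)) y
      = (1 : Matrix.unitaryGroup (Word F n m) ℂ).1.mulVec (fun x => if x = 0 then 1 else 0) y.1 *
        (rootCard F n m * (ψ y.2 * φ y.2)) := by
  have h2 : (fun z => ∑ x, wordFourier ψ x * wordFourier φ (z - x))
      = wordFourier (fun u => (rootCard F n m : ℂ) * (ψ u * φ u)) := by
    funext z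
    rw [sum_wordFourier_mul_wordFourier, wordFourier_apply, wordFourier_apply, mul_left_comm,
      Finset.mul_sum]
    congr 1
    exact Finset.sum_congr rfl fun x _ => by ring
  have h3 := congrArg (fun f => wordFourierInv f y.2) h2
  rw [wordFourierInv_wordFourier] at h3
  rw [tensorUnitary_mulVec 1 (qft F n m)⁻¹ (fun x => if x = 0 then 1 else 0)
    (fun z => ∑ x, wordFourier ψ x * wordFourier φ (z - x)) y, ← h3]
  rfl

/-- For fixed `z` at most one `x`, namely `G z`, contributes to the convolution. Subtracting it
clears the first register and leaves the whole convolution in the second. -/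
theorem decoded_eq_of_recovers (G : Word F n m → Word F n m) (a g : Word F n m → ℂ)
    (hG : ∀ x z, a x ≠ 0 → g (z - x) ≠ 0 → G z = x) (y z : Word F n m) :
    a (y + G z) * g (z - y - G z) = (if y = 0 then 1 else 0) * ∑ x, a x * g (z - x) := by
  have hx : ∀ x, a x * g (z - x) ≠ 0 → G z = x := fun x hx =>
    hG x z (left_ne_zero_of_mul hx) (right_ne_zero_of_mul hx)
  have hsub : z - y - G z = z - (y + G z) := by abel
  by_cases hy : y = 0
  · subst hy
    rw [if_pos rfl, one_mul, Finset.sum_eq_single (G z)]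
    · simp
    · intro x _ hne
      by_contra h
      exact hne (hx x h).symm
    · simp
  · rw [if_neg hy, zero_mul, hsub]
    by_contra h
    exact hy (by simpa using hx _ h)

/-- Adding and then decoding is a permutation of basis pairs for any `G`, so the squared norm
factors whether or not decoding succeeds. -/
theorem sum_norm_sq_shear (G : Word F n m → Word F n m) (a b : Word F n m → ℂ) :
    ∑ y : Word F n m × Word F n m, ‖a (y.1 + G y.2) * b (y.2 - y.1 - G y.2)‖ ^ 2
      = (∑ x, ‖a x‖ ^ 2) * ∑ z, ‖b z‖ ^ 2 := by
  rw [Finset.sum_mul_sum, ← Fintype.sum_prod_type',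
    ← Equiv.sum_comp (⟨fun y => (y.1 + G y.2, y.2 - y.1 - G y.2),
      fun y => (y.1 - G (y.1 + y.2), y.1 + y.2), fun y => by ext1 <;> simp,
      fun y => by ext1 <;> simp⟩ : Equiv.Perm (Word F n m × Word F n m))
      (fun y => ‖a y.1‖ ^ 2 * ‖b y.2‖ ^ 2)]
  simp only [Equiv.coe_fn_mk, norm_mul, mul_pow]

theorem sum_norm_sq_ideal (ψ b : Word F n m → ℂ) :
    ∑ y : Word F n m × Word F n m,
        ‖(if y.1 = 0 then 1 else 0) * ∑ x, wordFourier ψ x * b (y.2 - x)‖ ^ 2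
      = Fintype.card (Word F n m) * ∑ u, ‖ψ u‖ ^ 2 * ‖wordFourierInv b u‖ ^ 2 := by
  rw [← sum_norm_sq_convolution, Fintype.sum_prod_type, Finset.sum_eq_single 0]
  · simp
  · intro y _ hy
    simp [hy]
  · simp

/-- If `G` recovers every `x` in the support of the Fourier transform of `ψ` from `x + e`, where `e`
lies outside the set `B`, then the processed state is close to one proportional to `ψ φ`. -/
theorem sum_process_outside_le (G : Word F n m → Word F n m) (ψ φ : Word F n m → ℂ)
    (hψ : ∑ x, ‖ψ x‖ ^ 2 = 1) (B : Set (Word F n m)) [DecidablePred (· ∈ B)]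
    (hG : ∀ x z, wordFourier ψ x ≠ 0 → z - x ∉ B → G z = x)
    (V : Set (Word F n m)) [DecidablePred (· ∈ V)] (hV : ∀ u, u ∉ V → ψ u * φ u = 0) :
    ∑ y : Word F n m × Word F n m, (if y.2 ∈ V then 0 else
        ‖(processUnitary G : Matrix _ _ ℂ).mulVec
          (fun y : Word F n m × Word F n m => ψ y.1 * φ y.2) y‖ ^ 2)
      ≤ 2 * ∑ z, ‖restrictAmp B (wordFourier φ) z‖ ^ 2
        + 2 * (Fintype.card (Word F n m) * ∑ u, ‖ψ u‖ ^ 2 *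
            ‖wordFourierInv (restrictAmp B (wordFourier φ)) u‖ ^ 2) := by
  let T := (tensorUnitary 1 (qft F n m)⁻¹ : Matrix.unitaryGroup (Word F n m × Word F n m) ℂ)
  let v : (Word F n m → ℂ) → Word F n m × Word F n m → ℂ :=
    fun b y => wordFourier ψ (y.1 + G y.2) * b (y.2 - y.1 - G y.2)
  let w : (Word F n m → ℂ) → Word F n m × Word F n m → ℂ :=
    fun b y => (if y.1 = 0 then 1 else 0) * ∑ x, wordFourier ψ x * b (y.2 - x)
  have hTw : ∀ y, y.2 ∉ V → T.1.mulVec (w (wordFourier φ)) y = 0 := by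
    intro y hy
    refine (inverse_stage_convolution ψ φ y).trans ?_
    rw [hV _ hy, mul_zero, mul_zero]
  -- `v` and `w` are linear in `b` and agree on the part of the transform of `φ` outside `B`, where
  -- `G` recovers. Only the part on `B` survives in the difference.
  have hdiff : ∀ y, (v (wordFourier φ) - w (wordFourier φ)) y
      = v (restrictAmp B (wordFourier φ)) y + -(w (restrictAmp B (wordFourier φ)) y) := by
    rintro ⟨y, z⟩
    have h := decoded_eq_of_recovers G (wordFourier ψ)
      (fun z => wordFourier φ z - restrictAmp B (wordFourier φ) z)
      (fun x z hx hz => hG x z hx fun hB => hz (by simp [restrictAmp, hB])) y z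
    simp only [mul_sub, Finset.sum_sub_distrib] at h
    simp only [Pi.sub_apply, v, w]
    linear_combination h
  -- Outside `V` the ideal vector vanishes, so the actual amplitude there equals that of the
  -- difference. The sum can then be extended to all `y` and the unitary `T` removed.
  calc _ ≤ ∑ y, ‖T.1.mulVec (v (wordFourier φ) - w (wordFourier φ)) y‖ ^ 2 := by
        refine Finset.sum_le_sum fun y _ => ?_
        split_ifs with h
        · positivity
        · rw [processUnitary_mulVec, Matrix.mulVec_sub, Pi.sub_apply, hTw y h, sub_zero]
    _ = ∑ y, ‖v (restrictAmp B (wordFourier φ)) y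
          + -(w (restrictAmp B (wordFourier φ)) y)‖ ^ 2 := by
        rw [sum_norm_sq_unitary_mulVec]
        exact Finset.sum_congr rfl fun y _ => by rw [hdiff]
    _ ≤ ∑ y, (2 * ‖v (restrictAmp B (wordFourier φ)) y‖ ^ 2
          + 2 * ‖-(w (restrictAmp B (wordFourier φ)) y)‖ ^ 2) :=
        Finset.sum_le_sum fun y _ => norm_add_sq_le_two_mul _ _
    _ = _ := by
        simp only [norm_neg]
        rw [Finset.sum_add_distrib, ← Finset.mul_sum, ← Finset.mul_sum, sum_norm_sq_shear,
          sum_norm_sq_ideal, sum_norm_sq_wordFourier, hψ, one_mul]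

end Processing

/-! ### The biased distribution -/

section Biased

variable {A : Type} [Fintype A]

/-- The probability of a single function under the biased distribution. -/
def bitWeight (p : ℝ) (h : A → Bool) : ℝ := ∏ a, if h a = true then p else 1 - p

theorem biasedProb_eq_prod {n : ℕ} (p : ℝ) (H : Fin n → A → Bool) :
    biasedProb p H = ∏ i, bitWeight p (H i) := rfl

theorem bitWeight_nonneg {p : ℝ} (h0 : 0 ≤ p) (h1 : p ≤ 1) (h : A → Bool) :
    0 ≤ bitWeight p h :=
  Finset.prod_nonneg fun a _ => by split_ifs <;> linarith

theorem biasedProb_nonneg {p : ℝ} (h0 : 0 ≤ p) (h1 : p ≤ 1) {n : ℕ} (H : Fin n → A → Bool) :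
    0 ≤ biasedProb p H :=
  Finset.prod_nonneg fun _ _ => bitWeight_nonneg h0 h1 _

variable [DecidableEq A]

theorem sum_bitWeight (p : ℝ) : ∑ h : A → Bool, bitWeight p h = 1 := by
  unfold bitWeight
  rw [← Fintype.prod_sum (fun (_ : A) (b : Bool) => if b = true then p else 1 - p)]
  simp

theorem sum_biasedProb_mul_prod {n : ℕ} (p : ℝ) (f : Fin n → (A → Bool) → ℝ) :
    ∑ H : Fin n → A → Bool, biasedProb p H * ∏ i, f i (H i)
      = ∏ i, ∑ h, bitWeight p h * f i h := by
  rw [Fintype.prod_sum]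
  simp only [biasedProb_eq_prod, Finset.prod_mul_distrib]

theorem sum_biasedProb {n : ℕ} (p : ℝ) : ∑ H : Fin n → A → Bool, biasedProb p H = 1 := by
  have h := sum_biasedProb_mul_prod (n := n) (A := A) p fun _ _ => 1
  simpa [sum_bitWeight] using h

theorem sum_bitWeight_false (p : ℝ) (a : A) :
    ∑ h : A → Bool, bitWeight p h * (if h a = false then 1 else 0) = 1 - p := by
  have h1 : ∀ h : A → Bool, bitWeight p h * (if h a = false then 1 else 0)
      = ∏ x, (if h x = true then p else 1 - p) *
          (if x = a then (if h x = false then 1 else 0) else 1) := by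
    intro h
    rw [Finset.prod_mul_distrib, Finset.prod_ite_eq' Finset.univ a]
    simp [bitWeight]
  simp only [h1]
  rw [← Fintype.prod_sum (fun (x : A) (b : Bool) => (if b = true then p else 1 - p) *
    (if x = a then (if b = false then 1 else 0) else 1)), Finset.prod_eq_single a]
  · simp
  · intro b _ hb
    simp [hb]
  · simp

/-- Union bound over the `n` functions. -/
theorem sum_biasedProb_all_true_le {n : ℕ} {p : ℝ} (h0 : 0 ≤ p) (h1 : p ≤ 1) :
    ∑ H : Fin n → A → Bool, biasedProb p H * (if ∃ i, ∀ a, H i a = true then 1 else 0)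
      ≤ n * p ^ Fintype.card A := by
  have hone : ∀ i : Fin n, ∑ H : Fin n → A → Bool,
      biasedProb p H * (if ∀ a, H i a = true then 1 else 0) = p ^ Fintype.card A := by
    intro i
    have h := sum_biasedProb_mul_prod (n := n) (A := A) p
      fun j h => if j = i then (if ∀ a, h a = true then 1 else 0) else 1
    simp only [Finset.prod_ite_eq', Finset.mem_univ, if_true] at h
    rw [h, Finset.prod_eq_single i]
    · simp only [if_true]
      rw [Finset.sum_eq_single (fun _ => true)]
      · simp [bitWeight]
      · intro h _ hne
        rw [if_neg, mul_zero]
        exact fun hall => hne (funext hall)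
      · simp
    · intro j _ hj
      simp [hj, sum_bitWeight]
    · simp
  calc _ ≤ ∑ H : Fin n → A → Bool, ∑ i : Fin n,
        biasedProb p H * (if ∀ a, H i a = true then 1 else 0) := by
        refine Finset.sum_le_sum fun H _ => ?_
        rw [← Finset.mul_sum]
        refine mul_le_mul_of_nonneg_left ?_ (biasedProb_nonneg h0 h1 H)
        split_ifs with h
        · obtain ⟨i, hi⟩ := h
          have := Finset.single_le_sum (s := Finset.univ)
            (f := fun i : Fin n => if ∀ a, H i a = true then (1 : ℝ) else 0)
            (fun j _ => by split_ifs <;> norm_num) (Finset.mem_univ i)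
          simpa [hi] using this
        · exact Finset.sum_nonneg fun i _ => by split_ifs <;> norm_num
    _ = _ := by
        rw [Finset.sum_comm]
        simp only [hone, Finset.sum_const, Finset.card_univ, Fintype.card_fin, nsmul_eq_mul]

end Biased

/-! ### The zero states -/

section ZeroState

variable {A : Type} [Fintype A] [DecidableEq A]

/-- The support of `zeroState h`. -/
def zeroSupport (h : A → Bool) : Finset A :=
  if (Finset.univ.filter fun a => h a = false).Nonempty then Finset.univ.filter fun a => h a = false
  else Finset.univ

theorem filter_subset_zeroSupport (h : A → Bool) :
    (Finset.univ.filter fun a => h a = false) ⊆ zeroSupport h := by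
  unfold zeroSupport
  split_ifs
  · exact subset_rfl
  · exact Finset.subset_univ _

theorem zeroState_amp [Nonempty A] (h : A → Bool) (a : A) : (zeroState h).amp a
    = if a ∈ zeroSupport h then (((1 / Real.sqrt (zeroSupport h).card : ℝ)) : ℂ) else 0 := by
  unfold zeroState zeroSupport
  split_ifs <;> simp_all [QState.uniform]

theorem zeroState_amp_eq_zero [Nonempty A] {h : A → Bool} (hne : ∃ a, h a = false) {a : A}
    (ha : h a ≠ false) : (zeroState h).amp a = 0 := by
  have hS : (Finset.univ.filter fun a => h a = false).Nonempty := by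
    obtain ⟨b, hb⟩ := hne
    exact ⟨b, by simp [hb]⟩
  rw [zeroState_amp, zeroSupport, if_pos hS, if_neg (by simpa using ha)]

/-- The fallback support is the whole domain, itself invariant under permutations, so equivariance
holds with no exceptional case. -/
theorem zeroSupport_comp (e : Equiv.Perm A) (h : A → Bool) :
    zeroSupport (h ∘ e) = (zeroSupport h).map e.symm.toEmbedding := by
  have hS : (Finset.univ.filter fun a => (h ∘ e) a = false)
      = (Finset.univ.filter fun a => h a = false).map e.symm.toEmbedding := by
    ext a
    simp [Finset.mem_map_equiv]
  unfold zeroSupport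
  simp only [hS, Finset.map_nonempty]
  split_ifs
  · rfl
  · simp

theorem zeroState_comp_amp [Nonempty A] (e : Equiv.Perm A) (h : A → Bool) (a : A) :
    (zeroState (h ∘ e)).amp a = (zeroState h).amp (e a) := by
  rw [zeroState_amp, zeroState_amp, zeroSupport_comp, Finset.card_map]
  simp [Finset.mem_map_equiv]

theorem norm_sq_sum_zeroState [Nonempty A] (h : A → Bool) :
    ‖∑ a, (zeroState h).amp a‖ ^ 2 = (zeroSupport h).card := by
  simp only [zeroState_amp, Finset.sum_ite_mem, Finset.univ_inter, Finset.sum_const, nsmul_eq_mul]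
  rw [← Complex.ofReal_natCast, ← Complex.ofReal_mul, Complex.norm_real, Real.norm_eq_abs, sq_abs,
    mul_pow, div_pow, one_pow, Real.sq_sqrt (Nat.cast_nonneg _)]
  by_cases h0 : ((zeroSupport h).card : ℝ) = 0
  · simp [h0]
  · field_simp

end ZeroState

/-! ### Translation symmetry of the random input -/

section Input

variable {F : Type} [Field F] [Fintype F] [DecidableEq F] {n m : ℕ}

/-- The amplitudes of the joint message on the input `H`. -/
def inputAmp (H : Fin n → Alph F m → Bool) : Word F n m → ℂ :=
  fun x => ∏ i, (zeroState (H i)).amp (x i)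

/-- The input with its `i`-th function translated by `u i`. -/
def shiftInput (u : Word F n m) : Equiv.Perm (Fin n → Alph F m → Bool) where
  toFun := fun H i a => H i (a + u i)
  invFun := fun H i a => H i (a - u i)
  left_inv := by intro H; simp
  right_inv := by intro H; simp

theorem biasedProb_shiftInput (p : ℝ) (u : Word F n m) (H : Fin n → Alph F m → Bool) :
    biasedProb p (shiftInput u H) = biasedProb p H :=
  Finset.prod_congr rfl fun i _ =>
    Equiv.prod_comp (Equiv.addRight (u i)) fun a => if H i a = true then p else 1 - p

theorem inputAmp_shiftInput (u : Word F n m) (H : Fin n → Alph F m → Bool) :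
    inputAmp (shiftInput u H) = fun x => inputAmp H (x + u) := by
  funext x
  exact Finset.prod_congr rfl fun i _ => zeroState_comp_amp (Equiv.addRight (u i)) (H i) (x i)

variable (B : Set (Word F n m)) [DecidablePred (· ∈ B)]

/-- On the Fourier side a translation is multiplication by a phase, which commutes with restriction
to `B`. -/
theorem wordFourierInv_restrict_shiftInput (u : Word F n m) (H : Fin n → Alph F m → Bool) :
    wordFourierInv (restrictAmp B (wordFourier (inputAmp (shiftInput u H))))
      = fun x => wordFourierInv (restrictAmp B (wordFourier (inputAmp H))) (x + u) := by
  rw [← wordFourierInv_modulate, inputAmp_shiftInput]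
  congr 1
  funext z
  simp only [restrictAmp, wordFourier_shift]
  split_ifs <;> simp

theorem expected_norm_sq_wordFourierInv (p : ℝ) (u : Word F n m) :
    ∑ H : Fin n → Alph F m → Bool, biasedProb p H *
        ‖wordFourierInv (restrictAmp B (wordFourier (inputAmp H))) u‖ ^ 2
      = ∑ H : Fin n → Alph F m → Bool, biasedProb p H *
        ‖wordFourierInv (restrictAmp B (wordFourier (inputAmp H))) 0‖ ^ 2 := by
  rw [← Equiv.sum_comp (shiftInput u) fun H => biasedProb p H *
        ‖wordFourierInv (restrictAmp B (wordFourier (inputAmp H))) 0‖ ^ 2]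
  simp only [biasedProb_shiftInput, wordFourierInv_restrict_shiftInput, zero_add]

/-- Averaged over the input, every unit vector `ψ` gives the same error. -/
theorem expected_ideal_error (p : ℝ) (ψ : Word F n m → ℂ) (hψ : ∑ x, ‖ψ x‖ ^ 2 = 1) :
    ∑ H : Fin n → Alph F m → Bool, biasedProb p H *
        (Fintype.card (Word F n m) * ∑ u, ‖ψ u‖ ^ 2 *
          ‖wordFourierInv (restrictAmp B (wordFourier (inputAmp H))) u‖ ^ 2)
      = ∑ H : Fin n → Alph F m → Bool, biasedProb p H *
          ∑ z, ‖restrictAmp B (wordFourier (inputAmp H)) z‖ ^ 2 := by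
  set E := ∑ H : Fin n → Alph F m → Bool, biasedProb p H *
        ‖wordFourierInv (restrictAmp B (wordFourier (inputAmp H))) 0‖ ^ 2 with hE
  have key : ∀ f : Word F n m → ℝ, ∑ H : Fin n → Alph F m → Bool, biasedProb p H *
      ∑ u, f u * ‖wordFourierInv (restrictAmp B (wordFourier (inputAmp H))) u‖ ^ 2
      = (∑ u, f u) * E := by
    intro f
    simp only [Finset.mul_sum, Finset.sum_mul]
    rw [Finset.sum_comm]
    refine Finset.sum_congr rfl fun u _ => ?_
    rw [hE, ← expected_norm_sq_wordFourierInv B p u, Finset.mul_sum]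
    exact Finset.sum_congr rfl fun H _ => by ring
  -- With weight 1 Parseval identifies |Σⁿ|·`E` as the mean squared norm on `B`. The weight `‖ψ u‖ ^
  -- 2` has total mass 1 and gives `E` itself.
  have h1 := key fun _ => 1
  have h2 := key fun u => ‖ψ u‖ ^ 2
  simp only [one_mul, sum_norm_sq_wordFourierInv, Finset.sum_const, nsmul_eq_mul, mul_one,
    Finset.card_univ] at h1
  simp only [mul_left_comm (biasedProb p _) (Fintype.card (Word F n m) : ℝ)]
  rw [← Finset.mul_sum, h2, hψ, one_mul, h1]

/-! ### The Fourier transform of a product state -/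

/-- The Fourier transform on a single symbol. -/
def symbolFourier (g : Alph F m → ℂ) (e : Alph F m) : ℂ :=
  wordFourier (n := 1) (fun w => g (w 0)) fun _ => e

theorem symbolFourier_apply (g : Alph F m → ℂ) (e : Alph F m) :
    symbolFourier g e
      = (rootCard F 1 m : ℂ)⁻¹ * ∑ a, traceChar F (∑ j, a j * e j) * g a := by
  rw [symbolFourier, wordFourier_apply, ← Equiv.sum_comp (Equiv.funUnique (Fin 1) (Alph F m))]
  simp [wordDot]

theorem sum_norm_sq_symbolFourier (g : Alph F m → ℂ) :
    ∑ e, ‖symbolFourier g e‖ ^ 2 = ∑ a, ‖g a‖ ^ 2 := by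
  have h := sum_norm_sq_wordFourier (n := 1) fun w : Word F 1 m => g (w 0)
  rw [← Equiv.sum_comp (Equiv.funUnique (Fin 1) (Alph F m)).symm,
    ← Equiv.sum_comp (Equiv.funUnique (Fin 1) (Alph F m)).symm] at h
  exact h

theorem rootCard_eq_pow : rootCard F n m = rootCard F 1 m ^ n := by
  rw [← sq_eq_sq₀ rootCard_pos.le (pow_pos rootCard_pos n).le, ← pow_mul, mul_comm n 2, pow_mul,
    rootCard_sq, rootCard_sq]
  simp

theorem traceChar_sum (f : Fin n → F) : traceChar F (∑ i, f i) = ∏ i, traceChar F (f i) :=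
  map_prod (traceChar F).toMonoidHom (fun i => Multiplicative.ofAdd (f i)) Finset.univ

theorem wordFourier_prod (g : Fin n → Alph F m → ℂ) (z : Word F n m) :
    wordFourier (fun x => ∏ i, g i (x i)) z = ∏ i, symbolFourier (g i) (z i) := by
  simp only [symbolFourier_apply, Finset.prod_mul_distrib, Fintype.prod_sum]
  rw [wordFourier_apply, Finset.prod_const, Finset.card_univ, Fintype.card_fin, inv_pow,
    rootCard_eq_pow, Complex.ofReal_pow]
  congr 1
  refine Finset.sum_congr rfl fun x _ => ?_
  rw [wordDot, traceChar_sum]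

/-- The distribution of a single Fourier-transformed message symbol, averaged over the input. -/
def symbolDist (p : ℝ) (e : Alph F m) : ℝ :=
  ∑ h : Alph F m → Bool, bitWeight p h * ‖symbolFourier (zeroState h).amp e‖ ^ 2

theorem symbolDist_nonneg {p : ℝ} (h0 : 0 ≤ p) (h1 : p ≤ 1) (e : Alph F m) :
    0 ≤ symbolDist p e :=
  Finset.sum_nonneg fun h _ => mul_nonneg (bitWeight_nonneg h0 h1 h) (by positivity)

theorem sum_symbolDist (p : ℝ) : ∑ e : Alph F m, symbolDist p e = 1 := by
  unfold symbolDist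
  rw [Finset.sum_comm]
  simp only [← Finset.mul_sum, sum_norm_sq_symbolFourier, QState.norm_sq, mul_one, sum_bitWeight]

/-- The squared amplitude at 0 is the proportion of the alphabet in the support, and the zeros of h
have mean proportion 1 − p. Equality may fail because the fallback state enlarges an empty zero set
to the whole alphabet. -/
theorem one_sub_le_symbolDist_zero {p : ℝ} (h0 : 0 ≤ p) (h1 : p ≤ 1) :
    1 - p ≤ symbolDist p (0 : Alph F m) := by
  have hA : (0 : ℝ) < Fintype.card (Alph F m) := by exact_mod_cast Fintype.card_pos
  have hroot : rootCard F 1 m ^ 2 = Fintype.card (Alph F m) := by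
    rw [rootCard_sq]; simp
  have hz : ∀ h : Alph F m → Bool, ‖symbolFourier (zeroState h).amp 0‖ ^ 2
      = (Fintype.card (Alph F m) : ℝ)⁻¹ * (zeroSupport h).card := by
    intro h
    rw [symbolFourier_apply, norm_mul, mul_pow, norm_inv, Complex.norm_real, Real.norm_eq_abs,
      inv_pow, sq_abs, hroot, ← norm_sq_sum_zeroState]
    simp
  have hle : ∀ h : Alph F m → Bool, bitWeight p h * ((Fintype.card (Alph F m) : ℝ)⁻¹ *
      ∑ a, if h a = false then 1 else 0)
      ≤ bitWeight p h * ‖symbolFourier (zeroState h).amp 0‖ ^ 2 := by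
    intro h
    rw [hz]
    refine mul_le_mul_of_nonneg_left (mul_le_mul_of_nonneg_left ?_ (by positivity))
      (bitWeight_nonneg h0 h1 h)
    rw [Finset.sum_boole]
    exact_mod_cast Finset.card_le_card (filter_subset_zeroSupport h)
  calc 1 - p = (Fintype.card (Alph F m) : ℝ)⁻¹ * ∑ a : Alph F m, ∑ h : Alph F m → Bool,
        bitWeight p h * (if h a = false then 1 else 0) := by
        simp only [sum_bitWeight_false, Finset.sum_const, nsmul_eq_mul, Finset.card_univ]
        field_simp
    _ = ∑ h : Alph F m → Bool, bitWeight p h * ((Fintype.card (Alph F m) : ℝ)⁻¹ *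
          ∑ a, if h a = false then 1 else 0) := by
        rw [Finset.sum_comm, Finset.mul_sum]
        refine Finset.sum_congr rfl fun h _ => ?_
        rw [← Finset.mul_sum]
        ring
    _ ≤ _ := Finset.sum_le_sum fun h _ => hle h

/-- The transform of a product state is a product, and the H_i are independent, so the mean factors
over the symbols. -/
theorem expected_restrict (p : ℝ) :
    ∑ H : Fin n → Alph F m → Bool, biasedProb p H *
        ∑ z, ‖restrictAmp B (wordFourier (inputAmp H)) z‖ ^ 2
      = ∑ z, if z ∈ B then ∏ i, symbolDist p (z i) else 0 := by
  simp only [Finset.mul_sum]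
  rw [Finset.sum_comm]
  refine Finset.sum_congr rfl fun z _ => ?_
  split_ifs with hz
  · unfold symbolDist
    rw [← sum_biasedProb_mul_prod p fun i h => ‖symbolFourier (zeroState h).amp (z i)‖ ^ 2]
    refine Finset.sum_congr rfl fun H _ => ?_
    rw [restrictAmp, if_pos hz]
    unfold inputAmp
    rw [wordFourier_prod, norm_prod, Finset.prod_pow]
  · simp [restrictAmp, hz]

end Input

/-! ### Tail bound -/

section Tail

variable {A : Type} [Fintype A] [DecidableEq A] [Zero A] {n : ℕ}

/-- A Chernoff bound for the number of nonzero entries of a random tuple. -/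
theorem sum_prod_le_of_card_ne_zero (μ : A → ℝ) (hμ : ∀ a, 0 ≤ μ a) (hsum : ∑ a, μ a = 1)
    {p θ s : ℝ} (h0 : 1 - p ≤ μ 0) (hs : 0 ≤ s) (B : Set (Fin n → A)) [DecidablePred (· ∈ B)]
    (hB : ∀ z ∈ B, θ * n ≤ (Finset.univ.filter fun i => z i ≠ 0).card) :
    ∑ z : Fin n → A, (if z ∈ B then ∏ i, μ (z i) else 0)
      ≤ Real.exp ((p * (Real.exp s - 1) - s * θ) * n) := by
  -- Exponential Markov: on `B` the exponent `s * (number of nonzero entries - θ n)` is nonnegative.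
  have hterm : ∀ z : Fin n → A, (if z ∈ B then ∏ i, μ (z i) else 0)
      ≤ ∏ i, μ (z i) * Real.exp (s * ((if z i ≠ 0 then 1 else 0) - θ)) := by
    intro z
    have hprod : 0 ≤ ∏ i, μ (z i) := Finset.prod_nonneg fun i _ => hμ _
    rw [Finset.prod_mul_distrib, ← Real.exp_sum, ← Finset.mul_sum, Finset.sum_sub_distrib,
      Finset.sum_boole]
    split_ifs with hz
    · refine le_mul_of_one_le_right hprod (Real.one_le_exp (mul_nonneg hs ?_))
      have := hB z hz
      simp only [Finset.sum_const, Finset.card_univ, Fintype.card_fin, nsmul_eq_mul]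
      linarith
    · positivity
  have hone : ∑ a, μ a * Real.exp (s * ((if a ≠ 0 then 1 else 0) - θ))
      ≤ Real.exp (p * (Real.exp s - 1) - s * θ) := by
    have h1 : ∀ a, μ a * Real.exp (s * ((if a ≠ 0 then 1 else 0) - θ))
        = Real.exp (-(s * θ)) * (Real.exp s * μ a - (if a = 0 then (Real.exp s - 1) * μ 0 else 0)) := by
      intro a
      by_cases ha : a = 0
      · subst ha
        simp only [ne_eq, not_true_eq_false, if_false, if_true, zero_sub, mul_neg]
        ring
      · rw [if_pos ha, if_neg ha, mul_sub, mul_one, sub_eq_add_neg, Real.exp_add]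
        ring
    simp only [h1]
    rw [← Finset.mul_sum, Finset.sum_sub_distrib, ← Finset.mul_sum, hsum, Finset.sum_ite_eq',
      if_pos (Finset.mem_univ _), sub_eq_add_neg (p * _), add_comm (p * _), Real.exp_add]
    -- What remains is eˢ − (eˢ − 1) μ(0) ≤ 1 + p(eˢ − 1) ≤ exp(p(eˢ − 1)).
    refine mul_le_mul_of_nonneg_left ?_ (Real.exp_pos _).le
    have h2 : 0 ≤ Real.exp s - 1 := by linarith [Real.one_le_exp hs]
    have h3 := mul_le_mul_of_nonneg_left h0 h2
    have h4 := Real.add_one_le_exp (p * (Real.exp s - 1))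
    linarith
  calc _ ≤ ∑ z : Fin n → A, ∏ i, μ (z i) * Real.exp (s * ((if z i ≠ 0 then 1 else 0) - θ)) :=
        Finset.sum_le_sum fun z _ => hterm z
    _ = ∏ _i : Fin n, ∑ a, μ a * Real.exp (s * ((if a ≠ 0 then 1 else 0) - θ)) := by
        rw [Fintype.prod_sum]
    _ ≤ ∏ _i : Fin n, Real.exp (p * (Real.exp s - 1) - s * θ) :=
        Finset.prod_le_prod (fun i _ => Finset.sum_nonneg fun a _ =>
          mul_nonneg (hμ a) (Real.exp_pos _).le) fun i _ => hone
    _ = _ := by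
        rw [Finset.prod_const, Finset.card_univ, Fintype.card_fin, ← Real.exp_nat_mul, mul_comm]

end Tail

/-! ### The success probability of the protocol -/

section Protocol

variable {F : Type} [Field F] [Fintype F] [DecidableEq F] {n m : ℕ}

/-- The words on which the functions of the input `H` vanish. -/
def validSet (C : Submodule F (Fin (n * m) → F)) (H : Fin n → Alph F m → Bool) :
    Set (Word F n m) :=
  {u | u ∈ foldedCode C ∧ ∀ i, H i (u i) = false}

theorem biNC_iff (C : Submodule F (Fin (n * m) → F)) (H : Fin n → Alph F m → Bool)
    (u : Word F n m) :
    BiNC (foldedCode C) (firstHalf H) (secondHalf H) u ↔ u ∈ validSet C H := by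
  refine and_congr_right fun _ => ⟨fun h i => ?_, fun h => ⟨fun i => h _, fun i => h _⟩⟩
  obtain ⟨s, rfl⟩ := (halves n).surjective i
  rcases s with s | s
  · exact h.1 s
  · exact h.2 s

theorem message_amp (H : Fin n → Alph F m → Bool) (x : Word F n m) :
    ((QState.tensorPi fun i => zeroState (firstHalf H i)).tensor
      (QState.tensorPi fun i => zeroState (secondHalf H i))).amp (splitEquiv n (Alph F m) x)
      = inputAmp H x := by
  rw [inputAmp, ← Equiv.prod_comp (halves n), Fintype.prod_sum_type]
  rfl

theorem sum_norm_sq_inputAmp (H : Fin n → Alph F m → Bool) : ∑ x, ‖inputAmp H x‖ ^ 2 = 1 :=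
  (QState.tensorPi fun i => zeroState (H i)).norm_sq

/-- The state of Charlie's two registers before the measurement. -/
def finalAmp (C : Submodule F (Fin (n * m) → F)) (r : ℝ) (H : Fin n → Alph F m → Bool) :
    Word F n m × Word F n m → ℂ :=
  (processUnitary (decode (dualCode C) r)).1.mulVec
    fun y => (codeState C).amp y.1 * inputAmp H y.2

theorem sum_norm_sq_finalAmp (C : Submodule F (Fin (n * m) → F)) (r : ℝ)
    (H : Fin n → Alph F m → Bool) : ∑ y, ‖finalAmp C r H y‖ ^ 2 = 1 := by
  rw [finalAmp, sum_norm_sq_unitary_mulVec, Fintype.sum_prod_type]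
  simp only [norm_mul, mul_pow]
  rw [← Finset.sum_mul_sum, sum_norm_sq_inputAmp, QState.norm_sq, one_mul]

open Classical in
theorem successProb_eq (C : Submodule F (Fin (n * m) → F)) (r : ℝ)
    (H : Fin n → Alph F m → Bool) :
    (nullCodewordProtocol C r).successProb (BiNC (foldedCode C)) (firstHalf H) (secondHalf H)
      = ∑ y : Word F n m × Word F n m,
          if y.2 ∈ validSet C H then ‖finalAmp C r H y‖ ^ 2 else 0 := by
  let e := Equiv.prodCongr (Equiv.refl (Word F n m)) (splitEquiv n (Alph F m)).symm
  refine Fintype.sum_equiv e _ _ fun ω => if_congr (biNC_iff C H _) ?_ rfl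
  have h := congrFun (Matrix.submatrix_mulVec_equiv (processUnitary (decode (dualCode C) r)).1
    ((codeState C).tensor ((QState.tensorPi fun i => zeroState (firstHalf H i)).tensor
      (QState.tensorPi fun i => zeroState (secondHalf H i)))).amp e e) ω
  refine congrArg (fun c : ℂ => ‖c‖ ^ 2) (h.trans ?_)
  refine congrFun (congrArg _ (funext fun w => ?_)) (e ω)
  exact congrArg ((codeState C).amp w.1 * ·) (message_amp H w.2)

theorem successProb_nonneg (C : Submodule F (Fin (n * m) → F)) (r : ℝ)
    (H : Fin n → Alph F m → Bool) : 0 ≤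
    (nullCodewordProtocol C r).successProb (BiNC (foldedCode C)) (firstHalf H) (secondHalf H) := by
  rw [successProb_eq]
  exact Finset.sum_nonneg fun y _ => by split_ifs <;> positivity

/-- The words of unfolded weight greater than `r`. -/
def heavySet (F : Type) [Field F] [DecidableEq F] (n m : ℕ) (r : ℝ) : Set (Word F n m) :=
  {e | r < wordWeight e}

-- The last term covers inputs with some H_i identically 1: there the fallback message need not be
-- supported on zeros, and the term makes the bound trivial. For other inputs the failure
-- probability is the mass outside `validSet`.
open Classical in
theorem one_sub_le_successProb (C : Submodule F (Fin (n * m) → F)) {r : ℝ}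
    (hD : ∀ x ∈ dualCode C, x ≠ 0 → 2 * r < hammingNorm x) (H : Fin n → Alph F m → Bool) :
    1 - (2 * ∑ z, ‖restrictAmp (heavySet F n m r) (wordFourier (inputAmp H)) z‖ ^ 2
        + 2 * (Fintype.card (Word F n m) * ∑ u, ‖(codeState C).amp u‖ ^ 2 *
            ‖wordFourierInv (restrictAmp (heavySet F n m r) (wordFourier (inputAmp H))) u‖ ^ 2)
        + if ∃ i, ∀ a, H i a = true then 1 else 0)
      ≤ (nullCodewordProtocol C r).successProb (BiNC (foldedCode C))
          (firstHalf H) (secondHalf H) := by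
  by_cases hH : ∃ i, ∀ a, H i a = true
  · rw [if_pos hH]
    refine le_trans ?_ (successProb_nonneg C r H)
    rw [sub_nonpos]
    exact le_add_of_nonneg_left (by positivity)
  · rw [if_neg hH, add_zero]
    push Not at hH
    have hV : ∀ u, u ∉ validSet C H → (codeState C).amp u * inputAmp H u = 0 := by
      intro u hu
      by_cases hC : u ∈ foldedCode C
      · have hi : ∃ i, H i (u i) ≠ false := by
          by_contra! h
          exact hu ⟨hC, h⟩
        obtain ⟨i, hi⟩ := hi
        rw [inputAmp, Finset.prod_eq_zero (Finset.mem_univ i), mul_zero]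
        exact zeroState_amp_eq_zero (by simpa using hH i) hi
      · rw [codeState_amp_eq_zero C hC, zero_mul]
    have h := sum_process_outside_le (decode (dualCode C) r) (codeState C).amp (inputAmp H)
      (codeState C).norm_sq (heavySet F n m r) (fun x z hx hz => decode_eq hD
        (by
          by_contra h
          exact hx (wordFourier_codeState_eq_zero C h))
        (not_lt.1 hz)) (validSet C H) hV
    have hsplit : (1 : ℝ) = (∑ y : Word F n m × Word F n m,
          if y.2 ∈ validSet C H then ‖finalAmp C r H y‖ ^ 2 else 0)
        + ∑ y : Word F n m × Word F n m,
          if y.2 ∈ validSet C H then 0 else ‖finalAmp C r H y‖ ^ 2 := by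
      rw [← Finset.sum_add_distrib, ← sum_norm_sq_finalAmp C r H]
      exact Finset.sum_congr rfl fun y _ => by split_ifs <;> simp
    rw [successProb_eq, sub_le_iff_le_add]
    nth_rw 1 [hsplit]
    exact add_le_add le_rfl h

-- The factor 4 is 2 + 2: after averaging, the actual and the ideal error terms have the same mean,
-- which is the Chernoff tail.
open Classical in
theorem expected_successProb_ge (C : Submodule F (Fin (n * m) → F)) {r p θ s : ℝ}
    (hD : ∀ x ∈ dualCode C, x ≠ 0 → 2 * r < hammingNorm x) (hp0 : 0 ≤ p) (hp1 : p ≤ 1)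
    (hs : 0 ≤ s) (hm : 0 < m) (hr : r = θ * (n * m : ℕ)) :
    1 - (4 * Real.exp ((p * (Real.exp s - 1) - s * θ) * n) + n * p ^ Fintype.card (Alph F m))
      ≤ ∑ H : Fin n → Alph F m → Bool, biasedProb p H *
          (nullCodewordProtocol C r).successProb (BiNC (foldedCode C))
            (firstHalf H) (secondHalf H) := by
  have hheavy : ∀ z ∈ heavySet F n m r,
      θ * n ≤ (Finset.univ.filter fun i => z i ≠ 0).card := by
    intro z hz
    have h1 : (wordWeight z : ℝ) ≤ m * (Finset.univ.filter fun i => z i ≠ 0).card := by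
      exact_mod_cast wordWeight_le z
    have h2 : r < wordWeight z := hz
    have hm' : (0 : ℝ) < m := by exact_mod_cast hm
    rw [hr] at h2
    push_cast at h2
    refine le_of_mul_le_mul_left ?_ hm'
    linarith
  have htail := sum_prod_le_of_card_ne_zero (symbolDist p) (symbolDist_nonneg hp0 hp1)
    (sum_symbolDist p) (one_sub_le_symbolDist_zero hp0 hp1) hs (heavySet F n m r) hheavy
  have hempty := sum_biasedProb_all_true_le (A := Alph F m) (n := n) hp0 hp1
  have hres := expected_restrict (heavySet F n m r) p
  have hideal := expected_ideal_error (heavySet F n m r) p (codeState C).amp (codeState C).norm_sq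
  generalize Real.exp ((p * (Real.exp s - 1) - s * θ) * n) = T at htail ⊢
  refine le_trans ?_ (Finset.sum_le_sum fun H _ => mul_le_mul_of_nonneg_left
    (one_sub_le_successProb C hD H) (biasedProb_nonneg hp0 hp1 H))
  simp only [mul_sub, mul_one, mul_add (biasedProb p _), Finset.sum_sub_distrib,
    Finset.sum_add_distrib, sum_biasedProb, mul_left_comm (biasedProb p _) (2 : ℝ)]
  rw [← Finset.mul_sum, ← Finset.mul_sum, hideal, hres]
  linarith [hempty]

end Protocol

/-! ### The parameters of the Reed–Solomon instance -/

theorem cost_eq {F : Type} [Field F] [Fintype F] [DecidableEq F] {n m : ℕ}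
    (C : Submodule F (Fin (n * m) → F)) (r : ℝ) {l : ℕ} (hF : Fintype.card F = 2 ^ l) :
    (nullCodewordProtocol C r).cost = l * m * n := by
  have h : ∀ s : ℕ, Nat.clog 2 (Fintype.card (Fin s → Alph F m)) = l * m * s := by
    intro s
    simp only [Fintype.card_fun, Fintype.card_fin, hF, ← pow_mul]
    exact Nat.clog_pow 2 _ one_lt_two
  change Nat.clog 2 (Fintype.card (Fin (n / 2) → Alph F m))
    + Nat.clog 2 (Fintype.card (Fin (n - n / 2) → Alph F m)) = _
  rw [h, h, ← mul_add]
  congr 1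
  omega

theorem two_mul_decodingRadius_lt {F : Type} [Field F] [Fintype F] [DecidableEq F] {t : ℕ}
    (hF : Fintype.card F = 2 ^ (2 * t)) {γ : Fˣ} (hγ : ∀ y : Fˣ, y ∈ Subgroup.zpowers γ)
    {x₀ : F} (hx₀ : x₀ = 0 ∨ x₀ = 1) :
    ∀ x ∈ dualCode (baseCode t x₀ (γ : F)), x ≠ 0 →
      2 * decodingRadius t < hammingNorm x := by
  intro x hx hx0
  have hN : codeLen t * foldLen t + 1 = Fintype.card F := by
    rw [codeLen_mul_foldLen, hF, Nat.sub_add_cancel Nat.one_le_two_pow]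
  have h := lt_hammingNorm_of_mem_dualCode_rsCode (rsPoint_injective hN hγ hx₀) hx hx0
  -- The weight exceeds ⌊N/10⌋, hence also N/10. This suffices since 2(1/64 + 1/100) = 0.05125 <
  -- 1/10.
  have h2 : codeLen t * foldLen t < 10 * hammingNorm x := by omega
  have h3 : ((codeLen t * foldLen t : ℕ) : ℝ) < 10 * hammingNorm x := by exact_mod_cast h2
  have h4 : (0 : ℝ) ≤ ((codeLen t * foldLen t : ℕ) : ℝ) := Nat.cast_nonneg _
  rw [decodingRadius, biasP]
  linarith

theorem le_card_alph (F : Type) [Field F] [Fintype F] [DecidableEq F] (m : ℕ) :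
    m ≤ Fintype.card (Alph F m) := by
  rw [Fintype.card_fun, Fintype.card_fin]
  exact (Nat.lt_pow_self Fintype.one_lt_card).le

theorem exp_neg_le_two_rpow {c x : ℝ} (hc : 0 ≤ c * x) :
    Real.exp (-(c * x)) ≤ (2 : ℝ) ^ (-(c * x)) := by
  rw [Real.rpow_def_of_pos two_pos, Real.exp_le_exp]
  nlinarith [Real.log_two_lt_d9]

/-- From e < 2.89 = 1.7², the exponent is at most 0.7/64 − 0.025625/2 = −0.001875. -/
theorem tail_exponent_le :
    biasP * (Real.exp (1 / 2) - 1) - 1 / 2 * (biasP + 1 / 100) ≤ -(1 / 1000) := by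
  have h : Real.exp (1 / 2) ≤ 17 / 10 := by
    have h1 : Real.exp (1 / 2) ^ 2 = Real.exp 1 := by
      rw [← Real.exp_nat_mul]
      norm_num
    nlinarith [Real.exp_one_lt_d9, Real.exp_pos (1 / 2)]
  rw [biasP]
  linarith

theorem mul_biasP_pow_le {n k : ℕ} (hk : n ≤ k) :
    (n : ℝ) * biasP ^ k ≤ (2 : ℝ) ^ (-(1 / 1000 * (n : ℝ))) := by
  have h1 : biasP ^ k ≤ biasP ^ n :=
    pow_le_pow_of_le_one (by norm_num [biasP]) (by norm_num [biasP]) hk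
  have h2 : (n : ℝ) ≤ 2 ^ n := by exact_mod_cast Nat.lt_two_pow_self.le
  calc (n : ℝ) * biasP ^ k ≤ 2 ^ n * biasP ^ n := by
        have : 0 ≤ biasP ^ k := by rw [biasP]; positivity
        gcongr
    _ = (1 / 32) ^ n := by
        rw [← mul_pow, biasP]
        norm_num
    _ ≤ (1 / 2) ^ n := by
        gcongr
        norm_num
    _ = (2 : ℝ) ^ (-(n : ℝ)) := by
        rw [Real.rpow_neg two_pos.le, Real.rpow_natCast, one_div, inv_pow]
    _ ≤ _ := by
        refine Real.rpow_le_rpow_of_exponent_le one_le_two ?_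
        have : (0 : ℝ) ≤ n := Nat.cast_nonneg _
        linarith

theorem mainTheorem3 :
    ∃ (Q : Polynomial ℕ) (K c : ℝ), 0 < c ∧
      ∀ (t : ℕ), 1 ≤ t →
      ∀ (F : Type) [Field F] [Fintype F] [DecidableEq F], Fintype.card F = 2 ^ (2 * t) →
      ∀ (γ : Fˣ), (∀ y : Fˣ, y ∈ Subgroup.zpowers γ) →
      ∀ (x₀ : F), (x₀ = 0 ∨ x₀ = 1) →
        (nullCodewordProtocol (baseCode t x₀ (γ : F)) (decodingRadius t)).cost
            ≤ Q.eval (codeLen t) ∧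
        1 - K * (2 : ℝ) ^ (-(c * (codeLen t : ℝ))) ≤
          ∑ H : Fin (codeLen t) → Alph F (foldLen t) → Bool,
            biasedProb biasP H *
              (nullCodewordProtocol (baseCode t x₀ (γ : F)) (decodingRadius t)).successProb
                (BiNC (foldedCode (baseCode t x₀ (γ : F)))) (firstHalf H) (secondHalf H) := by
  -- The cost is 2t·m·n with t ≤ n and m = n + 2. The constant 5 adds four Chernoff tails and one
  -- term for a function without zeros.
  refine ⟨2 * Polynomial.X ^ 2 * (Polynomial.X + 2), 5, 1 / 1000, by norm_num,
    fun t _ F _ _ _ hF γ hγ x₀ hx₀ => ⟨?_, ?_⟩⟩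
  · rw [cost_eq _ _ hF]
    have h1 : t ≤ codeLen t := by
      have := Nat.lt_two_pow_self (n := t)
      simp only [codeLen]
      omega
    have h2 : foldLen t = codeLen t + 2 := by
      have := Nat.one_le_two_pow (n := t)
      simp only [codeLen, foldLen]
      omega
    simp only [Polynomial.eval_mul, Polynomial.eval_pow, Polynomial.eval_X, Polynomial.eval_add,
      Polynomial.eval_ofNat]
    rw [h2]
    calc 2 * t * (codeLen t + 2) * codeLen t
        ≤ 2 * codeLen t * (codeLen t + 2) * codeLen t := by gcongr
      _ = _ := by ring
  · have hp0 : 0 ≤ biasP := by norm_num [biasP]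
    have hp1 : biasP ≤ 1 := by norm_num [biasP]
    -- The choice s = 1/2 is close to the optimum log(θ/p) = log 1.64 ≈ 0.495.
    refine le_trans ?_ (expected_successProb_ge (baseCode t x₀ (γ : F)) (θ := biasP + 1 / 100)
      (s := 1 / 2) (two_mul_decodingRadius_lt hF hγ hx₀) hp0 hp1 (by norm_num)
      (Nat.succ_pos _) rfl)
    have hn : (0 : ℝ) ≤ codeLen t := Nat.cast_nonneg _
    have hle : codeLen t ≤ Fintype.card (Alph F (foldLen t)) :=
      le_trans ((Nat.sub_le _ _).trans (Nat.le_succ _)) (le_card_alph F (foldLen t))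
    have h1 := mul_biasP_pow_le hle
    have h2 : Real.exp ((biasP * (Real.exp (1 / 2) - 1) - 1 / 2 * (biasP + 1 / 100)) * codeLen t)
        ≤ (2 : ℝ) ^ (-(1 / 1000 * (codeLen t : ℝ))) := by
      refine le_trans (Real.exp_le_exp.2 ?_) (exp_neg_le_two_rpow (by positivity))
      rw [← neg_mul]
      exact mul_le_mul_of_nonneg_right tail_exponent_le hn
    linarith

end
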